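/- Conventions. Let $G$ be a connected real Lie group of dimension $n$, with Lie algebra $\mathcal G=T_eG$ (bracket of left-invariant vector fields). For a tensor $T$ on $\mathcal G$ let $T^+$ and $T^-$ be the left- and right-invariant tensor fields on $G$ with value $T$ at $e$. Let $\omega$ be a nondegenerate scalar 2-cocycle on $\mathcal G$, so that $(G,\omega^+)$ is a symplectic Lie group. Let $\nabla$ be the (flat, torsion-free, left-invariant) connection on $G$ determined by $$\omega^+(\nabla_{u^+}v^+,w^+)=-\omega^+(v^+,[u^+,w^+]),\qquad u,v,w\in\mathcal G,$$ and let $\pi^+$ be the left-invariant Poisson bivector field inverse to $\omega^+$, i.e. $\pi^+(i_X\omega^+,i_Y\omega^+)=\omega^+(X,Y)$, with bracket $\{f,h\}=\pi^+(df,dh)$. A smooth chart $(x_1,\dots,x_n)$ is called affine if $\nabla dx_i=0$ for all $i$. A tensor field on $G$ is called polynomial of degree at most $d$ if in every affine chart with connected domain its coefficients are polynomials of degree at most $d$ in $x_1,\dots,x_n$; it is polynomial if this holds for some $d$. $G$ is unimodular if $|\det \mathrm{Ad}_g|=1$ for all $g\in G$. Theorem 1.1. (1) For every basis $(u_1,\dots,u_n)$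 of $\mathcal G$ and every point of $G$ there is an affine chart $(x_1,\dots,x_n)$, defined on a connected neighborhood of that point, such that $i_{u_i^-}\omega^+=dx_i$ for all $i$, and constants $\mu_{ij}$ such that on this neighborhood $$\{x_i,x_j\}=\sum_{k=1}^n C_{ij}^k\,x_k+\mu_{ij}\qquad(1\le i,j\le n),$$ where $[u_i,u_j]=\sum_k C_{ij}^k u_k$. Moreover $\pi^+$ is polynomial of degree at most $1$. (2) For every $k\ge 0$, every right-invariant $k$-multivector field on $G$ is polynomial of degree at most $k$. (3) If $G$ is unimodular, then $\omega^+$ is polynomial of degree at most $n-1$, the form $\wedge^{n/2}\omega^+$ is parallel for $\nabla$, and every right-invariant differential form on $G$ is polynomial. (For $n=0$ the statement on $\omega^+$ is void.) -/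

import Mathlib

open scoped Manifold ContDiff Bundle

noncomputable section

namespace SymplecticLieGroup

/-! ### Linear algebra -/

section LinearAlgebra

/-- A nondegenerate scalar 2-cocycle `Ω` on a real Lie algebra `L`. -/
structure SymplecticCocycle (L : Type*) [LieRing L] [LieAlgebra ℝ L] where
  /-- the bilinear form `ω` -/
  form : LinearMap.BilinForm ℝ L
  alt : form.IsAlt
  nondegenerate : form.Nondegenerate
  cocycle : ∀ u v w : L, form ⁅u, v⁆ w + form ⁅v, w⁆ u + form ⁅w, u⁆ v = 0

variable {L : Type*} [LieRing L] [LieAlgebra ℝ L]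

/-- The cocycle, seen as an alternating form of degree 2: `(v₀, v₁) ↦ Ω(v₀, v₁)`. -/
def SymplecticCocycle.toForm (Ω : SymplecticCocycle L) : L [⋀^Fin 2]→ₗ[ℝ] ℝ where
  toFun v := Ω.form (v 0) (v 1)
  map_update_add' v i x y := by fin_cases i <;> simp
  map_update_smul' v i c x := by fin_cases i <;> simp
  map_eq_zero_of_eq' v i j h hij := by
    have h01 : v 0 = v 1 := by fin_cases i <;> fin_cases j <;> simp_all
    rw [h01]
    exact Ω.alt (v 1)

variable [FiniteDimensional ℝ L]

/-- The vector `α♯` determined by `Ω(α♯, ·) = α`. -/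
def SymplecticCocycle.sharp (Ω : SymplecticCocycle L) : Module.Dual ℝ L ≃ₗ[ℝ] L :=
  (Ω.form.toDual Ω.nondegenerate).symm

/-- The bivector `π` inverse to `Ω`, as an alternating form on the dual space:
`π(Ω(u, ·), Ω(v, ·)) = Ω(u, v)`. -/
def SymplecticCocycle.toBivector (Ω : SymplecticCocycle L) :
    (Module.Dual ℝ L) [⋀^Fin 2]→ₗ[ℝ] ℝ :=
  Ω.toForm.compLinearMap Ω.sharp.toLinearMap

/-- The product `u · v` on `L` determined by `Ω(u · v, w) = -Ω(v, [u, w])`. -/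
def SymplecticCocycle.product (Ω : SymplecticCocycle L) : L →ₗ[ℝ] L →ₗ[ℝ] L :=
  LinearMap.mk₂ ℝ (fun u v ↦ Ω.sharp (-(Ω.form v ∘ₗ (LieAlgebra.ad ℝ L u : L →ₗ[ℝ] L))))
    (fun u u' v ↦ by
      rw [← map_add]; congr 1; ext w; simp; ring)
    (fun c u v ↦ by
      rw [← map_smul]; congr 1; ext w; simp)
    (fun u v v' ↦ by
      rw [← map_add]; congr 1; ext w; simp; ring)
    (fun c u v ↦ by
      rw [← map_smul]; congr 1; ext w; simp)

theorem SymplecticCocycle.form_product (Ω : SymplecticCocycle L) (u v w : L) :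
    Ω.form (Ω.product u v) w = -Ω.form v ⁅u, w⁆ := by
  simp [SymplecticCocycle.product, SymplecticCocycle.sharp,
    LinearMap.BilinForm.apply_toDual_symm_apply]

variable {V : Type*} [AddCommGroup V] [Module ℝ V]

/-- The wedge product of alternating forms, normalized by
`(α ∧ β)(v) = ∑ sign σ · α(v_{σ 1}, …, v_{σ p}) β(v_{σ (p+1)}, …, v_{σ (p+q)})`,
the sum being over the `(p, q)`-shuffles. -/
def wedge {p q : ℕ} (α : V [⋀^Fin p]→ₗ[ℝ] ℝ) (β : V [⋀^Fin q]→ₗ[ℝ] ℝ) :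
    V [⋀^Fin (p + q)]→ₗ[ℝ] ℝ :=
  ((LinearMap.mul' ℝ ℝ).compAlternatingMap (α.domCoprod β)).domDomCongr finSumFinEquiv

/-- The `m`-th exterior power `α ∧ ⋯ ∧ α` of a form of degree 2. -/
def wedgePow (α : V [⋀^Fin 2]→ₗ[ℝ] ℝ) : (m : ℕ) → V [⋀^Fin (2 * m)]→ₗ[ℝ] ℝ
  | 0 => AlternatingMap.constOfIsEmpty ℝ V (Fin 0) 1
  | m + 1 => wedge (wedgePow α m) α

end LinearAlgebra

/-! ### Translations of a Lie group -/

section Translations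

variable {E : Type*} [NormedAddCommGroup E] [NormedSpace ℝ E]
  {G : Type*} [TopologicalSpace G] [ChartedSpace E G] [Group G]

instance instLieGroupMinSmoothness [LieGroup 𝓘(ℝ, E) ∞ G] :
    LieGroup 𝓘(ℝ, E) (minSmoothness ℝ 3) G :=
  LieGroup.of_le (n := ∞) (by
    simp only [minSmoothness_of_isRCLikeNormedField]
    exact WithTop.coe_le_coe.2 (le_top : (3 : ℕ∞) ≤ ⊤))

instance instFiniteDimensionalTangentSpace [FiniteDimensional ℝ E] (g : G) :
    FiniteDimensional ℝ (TangentSpace 𝓘(ℝ, E) g) :=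
  inferInstanceAs (FiniteDimensional ℝ E)

instance instT2TangentSpace (g : G) : T2Space (TangentSpace 𝓘(ℝ, E) g) :=
  inferInstanceAs (T2Space E)

/-- The differential at `1` of the left translation `h ↦ g * h`. -/
def leftTrans (g : G) : GroupLieAlgebra 𝓘(ℝ, E) G →L[ℝ] TangentSpace 𝓘(ℝ, E) g :=
  mfderiv 𝓘(ℝ, E) 𝓘(ℝ, E) (fun h : G ↦ g * h) 1

/-- The differential at `g` of the left translation `h ↦ g⁻¹ * h`, the inverse of
`leftTrans g`. -/
def leftTriv (g : G) : TangentSpace 𝓘(ℝ, E) g →L[ℝ] GroupLieAlgebra 𝓘(ℝ, E) G :=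
  mfderiv 𝓘(ℝ, E) 𝓘(ℝ, E) (fun h : G ↦ g⁻¹ * h) g

/-- The differential at `g` of the right translation `x ↦ x * h`. -/
def rightTrans (h g : G) : TangentSpace 𝓘(ℝ, E) g →L[ℝ] TangentSpace 𝓘(ℝ, E) (g * h) :=
  mfderiv 𝓘(ℝ, E) 𝓘(ℝ, E) (fun x : G ↦ x * h) g

/-- The right-invariant vector field `u⁻` with value `u` at `1`. (The left-invariant one is
Mathlib's `mulInvariantVectorField u`.) -/
def rightInvariantField (u : GroupLieAlgebra 𝓘(ℝ, E) G) (g : G) : TangentSpace 𝓘(ℝ, E) g :=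
  mfderiv 𝓘(ℝ, E) 𝓘(ℝ, E) (fun x : G ↦ x * g) 1 u

/-- The adjoint representation: `Ad g` is the differential at `1` of `h ↦ g * h * g⁻¹`. -/
def Ad (E : Type*) [NormedAddCommGroup E] [NormedSpace ℝ E]
    {G : Type*} [TopologicalSpace G] [ChartedSpace E G] [Group G] (g : G) : GroupLieAlgebra 𝓘(ℝ, E) G →L[ℝ] GroupLieAlgebra 𝓘(ℝ, E) G :=
  mfderiv 𝓘(ℝ, E) 𝓘(ℝ, E) (fun h : G ↦ g * h * g⁻¹) 1

variable (E G) in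
/-- A Lie group is unimodular if its modular function `g ↦ |det (Ad g)|` is constant equal
to `1`. -/
def IsUnimodular : Prop :=
  ∀ g : G, |LinearMap.det (Ad E g).toLinearMap| = 1

/-- A vector field `Y`, read in the left-invariant trivialization of the tangent bundle as a
function from `G` to the Lie algebra (whose underlying space is `E`). -/
def leftCoord (Y : (g : G) → TangentSpace 𝓘(ℝ, E) g) : G → E :=
  fun g ↦ leftTriv g (Y g)

variable [LieGroup 𝓘(ℝ, E) ∞ G]

theorem mdifferentiableAt_leftCoord {Y : (g : G) → TangentSpace 𝓘(ℝ, E) g} {g : G}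
    (hY : MDiffAt (T% Y) g) : MDiffAt (leftCoord Y) g := by
  let I := 𝓘(ℝ, E)
  let P : G × G → G := fun p ↦ p.1⁻¹ * p.2
  have hP : ContMDiff (I.prod I) I ∞ P := contMDiff_fst.inv.mul contMDiff_snd
  have hTP : ContMDiff (I.prod I).tangent I.tangent 1 (tangentMap (I.prod I) I P) :=
    hP.contMDiff_tangentMap (by exact WithTop.coe_le_coe.2 (le_top : (2 : ℕ∞) ≤ ⊤))
  have hzero : MDiffAt (fun h : G ↦ (⟨h, 0⟩ : TangentBundle I G)) g :=
    Bundle.mdifferentiableAt_zeroSection ..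
  let Q : G → TangentBundle (I.prod I) (G × G) := fun h ↦
    (equivTangentBundleProd I G I G).symm ((⟨h, 0⟩ : TangentBundle I G), ⟨h, Y h⟩)
  have hQ : MDiffAt Q g :=
    ((contMDiff_equivTangentBundleProd_symm (n := 1)).mdifferentiableAt (by simp)).comp g
      (hzero.prodMk hY)
  have h1 : MDiffAt (fun h ↦ tangentMap (I.prod I) I P (Q h)) g :=
    (hTP.mdifferentiableAt (by simp)).comp g hQ
  have h2 : ∀ h : G, tangentMap (I.prod I) I P (Q h)
      = (⟨1, leftTriv h (Y h)⟩ : TangentBundle I G) := by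
    intro h
    have hPd : MDiffAt P (h, h) := hP.mdifferentiableAt (by simp)
    let v : TangentSpace (I.prod I) (h, h) := ((0 : E), (Y h : E))
    have key := mfderiv_prod_eq_add_apply (v := v) hPd
    have hz : (mfderiv I I (fun z ↦ P (z, h)) h (0 : TangentSpace I h) : E) = 0 := map_zero _
    refine Bundle.TotalSpace.ext (inv_mul_cancel h) (heq_of_eq ?_)
    let w0 : E := leftTriv h (Y h)
    exact key.trans ((congrArg (fun w : E ↦ w + w0) hz).trans (zero_add w0))
  simp only [h2] at h1
  have h3 := ((mdifferentiableAt_totalSpace I _).1 h1).2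
  refine h3.congr_of_eventuallyEq (Filter.Eventually.of_forall fun h ↦ ?_)
  exact (tangentCoordChange_self (I := I) (x := (1 : G)) (v := leftCoord Y h)
    (mem_extChartAt_source 1)).symm

theorem leftTrans_leftTriv (g : G) (v : TangentSpace 𝓘(ℝ, E) g) :
    leftTrans g (leftTriv g v) = v := by
  have hd : ∀ a b : G, MDifferentiableAt 𝓘(ℝ, E) 𝓘(ℝ, E) (fun h : G ↦ a * h) b := fun a b ↦
    (contMDiff_mul_left (I := 𝓘(ℝ, E)) (n := ∞) (a := a)).mdifferentiableAt (by simp)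
  have h := mfderiv_comp_apply g (hd g (g⁻¹ * g)) (hd g⁻¹ g) v
  have hid : (fun h : G ↦ g * h) ∘ (fun h : G ↦ g⁻¹ * h) = id := by ext; simp
  rw [hid, mfderiv_id] at h
  have h1 : ∀ x : G, x = 1 → ∀ w : E,
      (mfderiv 𝓘(ℝ, E) 𝓘(ℝ, E) (fun h : G ↦ g * h) x : E → E) w = leftTrans g w := by
    rintro x rfl w; rfl
  exact (h1 _ (inv_mul_cancel g) _).symm.trans h.symm

theorem leftTriv_leftTrans (g : G) (v : GroupLieAlgebra 𝓘(ℝ, E) G) :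
    leftTriv g (leftTrans g v) = v := by
  have hd : ∀ a b : G, MDifferentiableAt 𝓘(ℝ, E) 𝓘(ℝ, E) (fun h : G ↦ a * h) b := fun a b ↦
    (contMDiff_mul_left (I := 𝓘(ℝ, E)) (n := ∞) (a := a)).mdifferentiableAt (by simp)
  have h := mfderiv_comp_apply 1 (hd g⁻¹ (g * 1)) (hd g 1) v
  have hid : (fun h : G ↦ g⁻¹ * h) ∘ (fun h : G ↦ g * h) = id := by ext; simp
  rw [hid, mfderiv_id] at h
  have h1 : ∀ x : G, x = g → ∀ w : E,
      (mfderiv 𝓘(ℝ, E) 𝓘(ℝ, E) (fun h : G ↦ g⁻¹ * h) x : E → E) w = leftTriv g w := by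
    rintro x rfl w; rfl
  exact (h1 _ (mul_one g) _).symm.trans h.symm

end Translations

/-! ### The connection of a symplectic Lie group -/

section Connection

variable {E : Type*} [NormedAddCommGroup E] [NormedSpace ℝ E] [FiniteDimensional ℝ E]
  {G : Type*} [TopologicalSpace G] [ChartedSpace E G] [Group G] [LieGroup 𝓘(ℝ, E) ∞ G]

/-- If `Y` is the vector field `g ↦ dL_g (F g)` with `F : G → L` and `v = dL_g ξ`, then
`∇_v Y = dL_g (dF v + ξ · F g)`. Note the order of arguments: `connectionFun Ω Y g v`. -/
def connectionFun (Ω : SymplecticCocycle (GroupLieAlgebra 𝓘(ℝ, E) G))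
    (Y : (g : G) → TangentSpace 𝓘(ℝ, E) g) (g : G) :
    TangentSpace 𝓘(ℝ, E) g →L[ℝ] TangentSpace 𝓘(ℝ, E) g :=
  let dF : TangentSpace 𝓘(ℝ, E) g →L[ℝ] GroupLieAlgebra 𝓘(ℝ, E) G :=
    mvfderiv 𝓘(ℝ, E) (leftCoord Y) g
  (leftTrans g).comp
    (dF + (LinearMap.toContinuousLinearMap (Ω.product.flip (leftTriv g (Y g)))).comp (leftTriv g))

theorem connectionFun_apply (Ω : SymplecticCocycle (GroupLieAlgebra 𝓘(ℝ, E) G))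
    (Y : (g : G) → TangentSpace 𝓘(ℝ, E) g) (g : G) (v : TangentSpace 𝓘(ℝ, E) g)
    (a : GroupLieAlgebra 𝓘(ℝ, E) G) (ha : mvfderiv 𝓘(ℝ, E) (leftCoord Y) g v = a) :
    connectionFun Ω Y g v
      = leftTrans g (a + Ω.product (leftTriv g v) (leftTriv g (Y g))) := by
  subst ha; rfl

/-- The connection `∇` associated to the symplectic Lie group `(G, Ω⁺)`; it is the connection
satisfying the identity of `connection_formula` below. Note the order of arguments:
`connection Ω Y g v` is `∇_v Y` at `g`. -/
def connection (Ω : SymplecticCocycle (GroupLieAlgebra 𝓘(ℝ, E) G)) :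
    CovariantDerivative 𝓘(ℝ, E) E (fun g : G ↦ TangentSpace 𝓘(ℝ, E) g) where
  toFun := connectionFun Ω
  isCovariantDerivativeOnUniv := by
    constructor
    · intro Y Z g hY hZ _
      ext v
      let a : GroupLieAlgebra 𝓘(ℝ, E) G := mvfderiv 𝓘(ℝ, E) (leftCoord Y) g v
      let b : GroupLieAlgebra 𝓘(ℝ, E) G := mvfderiv 𝓘(ℝ, E) (leftCoord Z) g v
      have h1 : leftCoord (Y + Z) = leftCoord Y + leftCoord Z := by
        ext h; exact map_add (leftTriv h) _ _
      have h2 : mvfderiv 𝓘(ℝ, E) (leftCoord (Y + Z)) g v = a + b := by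
        rw [h1, mvfderiv_add (mdifferentiableAt_leftCoord hY) (mdifferentiableAt_leftCoord hZ)]
        rfl
      have h3 : leftTriv g ((Y + Z) g) = leftTriv g (Y g) + leftTriv g (Z g) :=
        map_add (leftTriv g) _ _
      refine (connectionFun_apply Ω (Y + Z) g v (a + b) h2).trans ?_
      refine Eq.trans ?_ (congrArg₂ (· + ·) (connectionFun_apply Ω Y g v a rfl)
        (connectionFun_apply Ω Z g v b rfl)).symm
      rw [h3, (Ω.product (leftTriv g v)).map_add, add_add_add_comm, map_add]
    · intro Y f g hY hf _
      ext v
      let a : GroupLieAlgebra 𝓘(ℝ, E) G := mvfderiv 𝓘(ℝ, E) (leftCoord Y) g v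
      have h1 : leftCoord (f • Y) = f • leftCoord Y := by
        ext h; exact map_smul (leftTriv h) _ _
      have h2 : mvfderiv 𝓘(ℝ, E) (leftCoord (f • Y)) g v
          = f g • a + (mvfderiv 𝓘(ℝ, E) f g v) • leftTriv g (Y g) := by
        rw [h1, mvfderiv_smul hf (mdifferentiableAt_leftCoord hY)]
        rfl
      have h3 : leftTriv g ((f • Y) g) = f g • leftTriv g (Y g) :=
        map_smul (leftTriv g) _ _
      refine (connectionFun_apply Ω (f • Y) g v _ h2).trans ?_
      refine Eq.trans ?_ (congrArg (fun w ↦ f g • w + (mvfderiv 𝓘(ℝ, E) f g v) • Y g)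
        (connectionFun_apply Ω Y g v a rfl)).symm
      rw [h3, map_smul, add_right_comm, ← smul_add, map_add, map_smul, map_smul,
        leftTrans_leftTriv]

/-! ### Invariant tensor fields -/

/-- The left-invariant differential form `α⁺` with value `α` at `1`. -/
def leftInvariantForm {k : ℕ} (α : (GroupLieAlgebra 𝓘(ℝ, E) G) [⋀^Fin k]→ₗ[ℝ] ℝ) (g : G) :
    (TangentSpace 𝓘(ℝ, E) g) [⋀^Fin k]→ₗ[ℝ] ℝ :=
  α.compLinearMap (leftTriv g).toLinearMap

/-- The defining identity `Ω⁺(∇_{u⁺} v⁺, w⁺) = -Ω⁺(v⁺, [u, w]⁺)` of the connection. -/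
theorem connection_formula (Ω : SymplecticCocycle (GroupLieAlgebra 𝓘(ℝ, E) G))
    (u v w : GroupLieAlgebra 𝓘(ℝ, E) G) (g : G) :
    leftInvariantForm Ω.toForm g
        ![connection Ω (mulInvariantVectorField v) g (mulInvariantVectorField u g),
          mulInvariantVectorField w g]
      = -leftInvariantForm Ω.toForm g
        ![mulInvariantVectorField v g, mulInvariantVectorField ⁅u, w⁆ g] := by
  have hconst : ∃ c : E, leftCoord (mulInvariantVectorField v :
      (g : G) → TangentSpace 𝓘(ℝ, E) g) = fun _ ↦ c :=
    ⟨v, funext fun h ↦ leftTriv_leftTrans h v⟩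
  have hd : mvfderiv 𝓘(ℝ, E) (leftCoord (mulInvariantVectorField v)) g
      (mulInvariantVectorField u g) = (0 : GroupLieAlgebra 𝓘(ℝ, E) G) := by
    obtain ⟨c, hc⟩ := hconst
    rw [hc, mvfderiv_const]; rfl
  have h := connectionFun_apply Ω (mulInvariantVectorField v) g (mulInvariantVectorField u g) 0 hd
  have ht : ∀ z : GroupLieAlgebra 𝓘(ℝ, E) G, leftTriv g (mulInvariantVectorField z g) = z :=
    leftTriv_leftTrans g
  rw [ht, ht, zero_add] at h
  have h' : leftTriv g (connection Ω (mulInvariantVectorField v) g (mulInvariantVectorField u g))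
      = Ω.product u v := (congrArg (leftTriv g) h).trans (leftTriv_leftTrans g _)
  calc _ = Ω.form (leftTriv g
          (connection Ω (mulInvariantVectorField v) g (mulInvariantVectorField u g)))
          (leftTriv g (mulInvariantVectorField w g)) := rfl
    _ = -Ω.form (leftTriv g (mulInvariantVectorField v g))
          (leftTriv g (mulInvariantVectorField ⁅u, w⁆ g)) := by
        rw [h', ht, ht, ht, Ω.form_product]
    _ = _ := rfl

/-- The left-invariant `k`-multivector field with value `P` at `1`. Here and below a `k`-vector on
a (finite-dimensional) tangent space is an alternating `k`-linear form on its dual. -/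
def leftInvariantMultivector {k : ℕ}
    (P : (Module.Dual ℝ (GroupLieAlgebra 𝓘(ℝ, E) G)) [⋀^Fin k]→ₗ[ℝ] ℝ) (g : G) :
    (Module.Dual ℝ (TangentSpace 𝓘(ℝ, E) g)) [⋀^Fin k]→ₗ[ℝ] ℝ :=
  P.compLinearMap (leftTrans g).toLinearMap.dualMap

/-- The symplectic form `Ω⁺` of the symplectic Lie group. -/
def symplecticForm (Ω : SymplecticCocycle (GroupLieAlgebra 𝓘(ℝ, E) G)) (g : G) :
    (TangentSpace 𝓘(ℝ, E) g) [⋀^Fin 2]→ₗ[ℝ] ℝ :=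
  leftInvariantForm Ω.toForm g

/-- The left-invariant Poisson bivector field `π⁺` of the symplectic Lie group. -/
def poissonBivector (Ω : SymplecticCocycle (GroupLieAlgebra 𝓘(ℝ, E) G)) (g : G) :
    (Module.Dual ℝ (TangentSpace 𝓘(ℝ, E) g)) [⋀^Fin 2]→ₗ[ℝ] ℝ :=
  leftInvariantMultivector Ω.toBivector g

/-- The differential of a real function at `g`, as a linear form on the tangent space. -/
def differential (f : G → ℝ) (g : G) : Module.Dual ℝ (TangentSpace 𝓘(ℝ, E) g) :=
  (mvfderiv 𝓘(ℝ, E) f g).toLinearMap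

/-- The Poisson bracket `{f, h} = π⁺(df, dh)`. -/
def poissonBracket (Ω : SymplecticCocycle (GroupLieAlgebra 𝓘(ℝ, E) G)) (f h : G → ℝ) (g : G) : ℝ :=
  poissonBivector Ω g ![differential f g, differential h g]

/-- A differential form `α` on `G` is right-invariant if all right translations preserve it. -/
def IsRightInvariantForm {k : ℕ}
    (α : (g : G) → (TangentSpace 𝓘(ℝ, E) g) [⋀^Fin k]→ₗ[ℝ] ℝ) : Prop :=
  ∀ h g : G, (α (g * h)).compLinearMap (rightTrans h g).toLinearMap = α g

/-- A multivector field `P` on `G` is right-invariant if all right translations preserve it. -/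
def IsRightInvariantMultivector {k : ℕ}
    (P : (g : G) → (Module.Dual ℝ (TangentSpace 𝓘(ℝ, E) g)) [⋀^Fin k]→ₗ[ℝ] ℝ) : Prop :=
  ∀ h g : G, (P g).compLinearMap (rightTrans h g).toLinearMap.dualMap = P (g * h)

/-! ### Affine charts and polynomial tensor fields -/

/-- A differential form `α` is parallel on `U` for the connection `cov` if, at all points of `U`,
`v (α(Y₁, …, Y_k)) = ∑ i, α(Y₁, …, ∇_v Y_i, …, Y_k)` for all tangent vectors `v` and all
vector fields `Y_i`, that is, if `(∇_v α)(Y₁, …, Y_k) = 0`. -/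
def IsParallelOn (cov : CovariantDerivative 𝓘(ℝ, E) E (fun g : G ↦ TangentSpace 𝓘(ℝ, E) g))
    {k : ℕ} (α : (g : G) → (TangentSpace 𝓘(ℝ, E) g) [⋀^Fin k]→ₗ[ℝ] ℝ) (U : Set G) : Prop :=
  ∀ g ∈ U, ∀ Y : Fin k → (h : G) → TangentSpace 𝓘(ℝ, E) h,
    (∀ i, MDiffAt (T% (Y i)) g) →
      MDifferentiableAt 𝓘(ℝ, E) 𝓘(ℝ, ℝ) (fun h ↦ α h (fun j ↦ Y j h)) g ∧
      ∀ v : TangentSpace 𝓘(ℝ, E) g,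
        differential (fun h ↦ α h (fun j ↦ Y j h)) g v
          = ∑ i, α g (Function.update (fun j ↦ Y j g) i (cov (Y i) g v))

variable (E G) in
/-- A smooth chart of `G` with values in `ℝⁿ`. -/
abbrev Chart (n : ℕ) : Type _ :=
  PartialDiffeomorph 𝓘(ℝ, E) 𝓘(ℝ, Fin n → ℝ) G (Fin n → ℝ) ∞

variable {n : ℕ}

/-- The coordinate function `x_i`. -/
def Chart.coord (x : Chart E G n) (i : Fin n) : G → ℝ := fun g ↦ x g i

/-- The coordinate covector `dx_i` at `g`. -/
def Chart.dcoord (x : Chart E G n) (i : Fin n) (g : G) :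
    Module.Dual ℝ (TangentSpace 𝓘(ℝ, E) g) :=
  differential (x.coord i) g

/-- The coordinate vector `∂/∂x_i` at a point `g` of the domain of `x`. -/
def Chart.coordVec (x : Chart E G n) (i : Fin n) (g : G) : TangentSpace 𝓘(ℝ, E) g :=
  mfderiv 𝓘(ℝ, Fin n → ℝ) 𝓘(ℝ, E) x.invFun (x g) (Pi.single i 1 : Fin n → ℝ)

/-- The chart `x` is affine for the connection `cov` if the forms `dx_i` are parallel. -/
def Chart.IsAffine (x : Chart E G n)
    (cov : CovariantDerivative 𝓘(ℝ, E) E (fun g : G ↦ TangentSpace 𝓘(ℝ, E) g)) : Prop :=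
  ∀ i, IsParallelOn cov
    (fun g ↦ AlternatingMap.ofSubsingleton ℝ (TangentSpace 𝓘(ℝ, E) g) ℝ (0 : Fin 1) (x.dcoord i g))
    x.source

/-- On the domain of `x`, the function `f` is a polynomial of degree at most `d` in the
coordinates. -/
def Chart.IsPolynomial (x : Chart E G n) (f : G → ℝ) (d : ℕ) : Prop :=
  ∃ p : MvPolynomial (Fin n) ℝ, p.totalDegree ≤ d ∧ ∀ g ∈ x.source, f g = MvPolynomial.eval (x g) p

/-- A differential form is polynomial of degree at most `d` if its coefficients in every affine
chart with connected domain are polynomials of degree at most `d` in the coordinates. -/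
def IsPolynomialForm
    (cov : CovariantDerivative 𝓘(ℝ, E) E (fun g : G ↦ TangentSpace 𝓘(ℝ, E) g))
    {k : ℕ} (α : (g : G) → (TangentSpace 𝓘(ℝ, E) g) [⋀^Fin k]→ₗ[ℝ] ℝ) (d : ℕ) : Prop :=
  ∀ x : Chart E G (Module.finrank ℝ E), x.IsAffine cov → IsPreconnected x.source →
    ∀ s : Fin k → Fin (Module.finrank ℝ E),
      x.IsPolynomial (fun g ↦ α g (fun j ↦ x.coordVec (s j) g)) d

/-- A multivector field is polynomial of degree at most `d` if its coefficients in every affine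
chart with connected domain are polynomials of degree at most `d` in the coordinates. -/
def IsPolynomialMultivector
    (cov : CovariantDerivative 𝓘(ℝ, E) E (fun g : G ↦ TangentSpace 𝓘(ℝ, E) g))
    {k : ℕ} (P : (g : G) → (Module.Dual ℝ (TangentSpace 𝓘(ℝ, E) g)) [⋀^Fin k]→ₗ[ℝ] ℝ)
    (d : ℕ) : Prop :=
  ∀ x : Chart E G (Module.finrank ℝ E), x.IsAffine cov → IsPreconnected x.source →
    ∀ s : Fin k → Fin (Module.finrank ℝ E),
      x.IsPolynomial (fun g ↦ P g (fun j ↦ x.dcoord (s j) g)) d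

end Connection
end SymplecticLieGroup
end

open SymplecticLieGroup

open scoped Topology

noncomputable section

namespace SymplecticLieGroup

/-! Trivialize all tensor fields by left translations: a vector field becomes a function into the
Lie algebra, and a one-form becomes Ω(b, ·) for such a function b. Since Ω(b, ξ · η) = -Ω([ξ, b],
η), the form is parallel exactly when db(ξ) = -[ξ, b]. On a connected open set the solutions are
b(g) = Ad g⁻¹ c with c constant (`exists_eq_adInv`), and Ad g⁻¹ c is the right-invariant field c⁻ in
this trivialization. So on a nonempty connected domain the affine charts are those with dx_i =
i_{c_i⁻} Ω⁺ for a basis (c_i) (`Chart.IsAffine.exists_basis`, `Chart.isAffine_of_dcoord_eq`). They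
exist because these one-forms are closed, by the Maurer–Cartan equation and the cocycle identity
(`exists_chart_hasFrame`).

The cocycle identity also gives d(Ω⁺(u⁻, v⁻)) = i_{[u, v]⁻} Ω⁺. Hence Ω⁺(u⁻, v⁻) is an affine
function of the coordinates, whose linear part is given by the coordinates of [u, v] in the basis
(c_k) (`Chart.HasFrame.isPolynomial_form`). The functions Ω⁺(c_i⁻, c_j⁻) are the coefficients of π⁺,
and also the numbers dx_i(c_j⁻); expanding by multilinearity settles right-invariant multivectors.

If G is unimodular, the matrix of these functions has constant determinant, being congruent to its
value at 1 through a matrix of determinant ±1. Its inverse, which expresses the ∂/∂x_j through the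
c_l⁻, therefore has entries of degree at most n - 1. These entries are, up to transposition, the
coefficients of Ω⁺, and they bound those of right-invariant forms. Finally, left multiplication by u
is minus the Ω-adjoint of ad u, so it acts trivially on top forms, and the left-invariant volume is
parallel (`sum_form_update_productCLM`). -/

/-! ### Calculus in the preferred chart at the identity -/

section UnitChart

variable (E : Type*) [NormedAddCommGroup E] [NormedSpace ℝ E]
  (G : Type*) [TopologicalSpace G] [ChartedSpace E G] [Group G]

/-- The preferred chart at the identity of a Lie group. -/
def unitChart (g : G) : E := extChartAt 𝓘(ℝ, E) (1 : G) g

variable {E} in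
/-- The inverse of the preferred chart at the identity. -/
def unitParam (y : E) : G := (extChartAt 𝓘(ℝ, E) (1 : G)).symm y

/-- The image of the identity in the preferred chart at the identity. -/
def unitPt : E := unitChart E G 1

/-- The domain of the preferred chart at the identity. -/
def unitSource : Set G := (extChartAt 𝓘(ℝ, E) (1 : G)).source

/-- The image of the preferred chart at the identity. -/
def unitTarget : Set E := (extChartAt 𝓘(ℝ, E) (1 : G)).target

theorem isOpen_unitSource : IsOpen (unitSource E G) := isOpen_extChartAt_source _

theorem isOpen_unitTarget : IsOpen (unitTarget E G) := isOpen_extChartAt_target _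

theorem one_mem_unitSource : (1 : G) ∈ unitSource E G := mem_extChartAt_source _

theorem unitPt_mem_unitTarget : unitPt E G ∈ unitTarget E G := mem_extChartAt_target _

theorem unitTarget_mem_nhds : unitTarget E G ∈ 𝓝 (unitPt E G) :=
  (isOpen_unitTarget E G).mem_nhds (unitPt_mem_unitTarget E G)

@[simp] theorem unitParam_unitPt : unitParam G (unitPt E G) = 1 := extChartAt_to_inv _

variable {E G}

theorem unitChart_unitParam {y : E} (hy : y ∈ unitTarget E G) :
    unitChart E G (unitParam G y) = y :=
  (extChartAt 𝓘(ℝ, E) (1 : G)).right_inv hy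

theorem unitParam_unitChart {g : G} (hg : g ∈ unitSource E G) :
    unitParam G (unitChart E G g) = g :=
  (extChartAt 𝓘(ℝ, E) (1 : G)).left_inv hg

theorem unitParam_mem {y : E} (hy : y ∈ unitTarget E G) : unitParam G y ∈ unitSource E G :=
  (extChartAt 𝓘(ℝ, E) (1 : G)).map_target hy

theorem unitChart_mem {g : G} (hg : g ∈ unitSource E G) : unitChart E G g ∈ unitTarget E G :=
  (extChartAt 𝓘(ℝ, E) (1 : G)).map_source hg

variable [LieGroup 𝓘(ℝ, E) ∞ G]

theorem contMDiffAt_unitChart {g : G} (hg : g ∈ unitSource E G) :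
    ContMDiffAt 𝓘(ℝ, E) 𝓘(ℝ, E) ∞ (unitChart E G) g :=
  contMDiffAt_extChartAt' (by simpa [unitSource] using hg)

theorem contMDiffAt_unitParam {y : E} (hy : y ∈ unitTarget E G) :
    ContMDiffAt 𝓘(ℝ, E) 𝓘(ℝ, E) ∞ (unitParam G : E → G) y :=
  (contMDiffOn_extChartAt_symm (1 : G)).contMDiffAt ((isOpen_unitTarget E G).mem_nhds hy)

theorem continuousAt_unitParam {y : E} (hy : y ∈ unitTarget E G) :
    ContinuousAt (unitParam G : E → G) y := (contMDiffAt_unitParam hy).continuousAt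

/-- Reading a smooth map into the group in the chart at the identity. -/
theorem contDiffAt_unitChart_comp {F : Type*} [NormedAddCommGroup F] [NormedSpace ℝ F]
    {f : F → G} {p : F} (hf : ContMDiffAt 𝓘(ℝ, F) 𝓘(ℝ, E) ∞ f p) (hp : f p ∈ unitSource E G) :
    ContDiffAt ℝ ∞ (fun q ↦ unitChart E G (f q)) p :=
  ((contMDiffAt_unitChart hp).comp p hf).contDiffAt

/-- Smooth maps into the group given by `unitParam`. -/
theorem contMDiffAt_unitParam_comp {F : Type*} [NormedAddCommGroup F] [NormedSpace ℝ F]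
    {f : F → E} {p : F} (hf : ContDiffAt ℝ ∞ f p) (hp : f p ∈ unitTarget E G) :
    ContMDiffAt 𝓘(ℝ, F) 𝓘(ℝ, E) ∞ (fun q ↦ unitParam G (f q)) p :=
  (contMDiffAt_unitParam hp).comp p hf.contMDiffAt

/-- The tangent space at 1 is, by construction, the model space read through this very chart, so
that no change of coordinates appears. -/
theorem mfderiv_unitChart_one :
    HasMFDerivAt 𝓘(ℝ, E) 𝓘(ℝ, E) (unitChart E G) 1 (ContinuousLinearMap.id ℝ E) := by
  have h := (contMDiffAt_unitChart (one_mem_unitSource E G)).mdifferentiableAt (by simp)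
  refine ⟨h.continuousAt, ?_⟩
  have h1 : (writtenInExtChartAt 𝓘(ℝ, E) 𝓘(ℝ, E) (1 : G) (unitChart E G))
      =ᶠ[𝓝 (unitPt E G)] id := by
    filter_upwards [unitTarget_mem_nhds E G] with y hy
    exact unitChart_unitParam hy
  exact ((hasFDerivAt_id _).congr_of_eventuallyEq h1).hasFDerivWithinAt

theorem mfderiv_unitParam_unitPt :
    HasMFDerivAt 𝓘(ℝ, E) 𝓘(ℝ, E) (unitParam G : E → G) (unitPt E G)
      (ContinuousLinearMap.id ℝ E) := by
  have h := (contMDiffAt_unitParam (unitPt_mem_unitTarget E G)).mdifferentiableAt (by simp)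
  refine ⟨h.continuousAt, ?_⟩
  have h1 : (writtenInExtChartAt 𝓘(ℝ, E) 𝓘(ℝ, E) (unitPt E G) (unitParam G : E → G))
      =ᶠ[𝓝 (unitPt E G)] id := by
    filter_upwards [unitTarget_mem_nhds E G] with y hy
    rw [writtenInExtChartAt, unitParam_unitPt]
    exact unitChart_unitParam hy
  exact ((hasFDerivAt_id _).congr_of_eventuallyEq h1).hasFDerivWithinAt

end UnitChart

/-! ### Differentiation in the left-invariant trivialization. -/

section LeftDerivative

variable {E : Type*} [NormedAddCommGroup E] [NormedSpace ℝ E]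
  {G : Type*} [TopologicalSpace G] [ChartedSpace E G] [Group G]
  {F : Type*} [NormedAddCommGroup F] [NormedSpace ℝ F]

/-- The function `f` on the group has derivative `f'` at `g` in the left-invariant trivialization
of the tangent bundle: `df (dL_g ξ) = f' ξ`. -/
def HasLeftDerivAt (f : G → F) (f' : E →L[ℝ] F) (g : G) : Prop :=
  HasFDerivAt (fun y : E ↦ f (g * unitParam G y)) f' (unitPt E G)

theorem eventually_mem_unitSource {f : E → G} {y : E} (hf : ContinuousAt f y)
    (h : f y ∈ unitSource E G) : ∀ᶠ z in 𝓝 y, f z ∈ unitSource E G :=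
  hf.preimage_mem_nhds ((isOpen_unitSource E G).mem_nhds h)

theorem HasLeftDerivAt.congr_of_eventuallyEq [LieGroup 𝓘(ℝ, E) ∞ G]
    {f f₁ : G → F} {f' : E →L[ℝ] F} {g : G}
    (h : HasLeftDerivAt f f' g) (h₁ : f₁ =ᶠ[𝓝 g] f) : HasLeftDerivAt f₁ f' g := by
  refine HasFDerivAt.congr_of_eventuallyEq h ?_
  have hc : ContinuousAt (fun y : E ↦ g * unitParam G y) (unitPt E G) := by
    have : IsTopologicalGroup G := topologicalGroup_of_lieGroup 𝓘(ℝ, E) ∞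
    exact (continuousAt_unitParam (unitPt_mem_unitTarget E G)).const_mul g
  have : Filter.Tendsto (fun y : E ↦ g * unitParam G y) (𝓝 (unitPt E G)) (𝓝 g) := by
    simpa [ContinuousAt] using hc
  exact this.eventually h₁

variable [LieGroup 𝓘(ℝ, E) ∞ G]

theorem exists_hasLeftDerivAt {f : G → F} {g : G}
    (hf : MDifferentiableAt 𝓘(ℝ, E) 𝓘(ℝ, F) f g) : ∃ f' : E →L[ℝ] F, HasLeftDerivAt f f' g := by
  have h1 : MDifferentiableAt 𝓘(ℝ, E) 𝓘(ℝ, E) (fun y : E ↦ g * unitParam G y) (unitPt E G) :=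
    ((contMDiff_mul_left (I := 𝓘(ℝ, E)) (n := ∞) (a := g)).mdifferentiableAt (by simp)).comp _
      ((contMDiffAt_unitParam (unitPt_mem_unitTarget E G)).mdifferentiableAt (by simp))
  have h2 : MDifferentiableAt 𝓘(ℝ, E) 𝓘(ℝ, F) f (g * unitParam G (unitPt E G)) := by simpa
  exact ⟨_, (h2.comp (unitPt E G) h1).differentiableAt.hasFDerivAt⟩

/-- Left translation by g⁻¹ brings g to 1, where the chart has derivative the identity. This is the
bridge between manifold derivatives and `HasLeftDerivAt`. -/
theorem hasMFDerivAt_leftTriv (g : G) :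
    HasMFDerivAt 𝓘(ℝ, E) 𝓘(ℝ, E) (fun h : G ↦ unitChart E G (g⁻¹ * h)) g
      (leftTriv g : E →L[ℝ] E) := by
  have h1 : HasMFDerivAt 𝓘(ℝ, E) 𝓘(ℝ, E) (fun h : G ↦ g⁻¹ * h) g (leftTriv g : E →L[ℝ] E) :=
    ((contMDiff_mul_left (I := 𝓘(ℝ, E)) (n := ∞) (a := g⁻¹)).mdifferentiableAt
      (by simp)).hasMFDerivAt
  have h2 : HasMFDerivAt 𝓘(ℝ, E) 𝓘(ℝ, E) (unitChart E G) (g⁻¹ * g)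
      (ContinuousLinearMap.id ℝ E) := by
    rw [inv_mul_cancel]
    exact mfderiv_unitChart_one
  exact h2.comp g h1

theorem HasLeftDerivAt.hasMFDerivAt {f : G → F} {f' : E →L[ℝ] F} {g : G}
    (hf : HasLeftDerivAt f f' g) :
    HasMFDerivAt 𝓘(ℝ, E) 𝓘(ℝ, F) f g (f'.comp (leftTriv g : E →L[ℝ] E)) := by
  have h1 := hasMFDerivAt_leftTriv (E := E) g
  have hpt : unitChart E G (g⁻¹ * g) = unitPt E G := by rw [inv_mul_cancel]; rfl
  have h2 : HasMFDerivAt 𝓘(ℝ, E) 𝓘(ℝ, F) (fun y : E ↦ f (g * unitParam G y))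
      (unitChart E G (g⁻¹ * g)) f' := by
    rw [hpt]
    exact HasFDerivAt.hasMFDerivAt hf
  refine (h2.comp g h1).congr_of_eventuallyEq ?_
  have hs : (fun h : G ↦ g⁻¹ * h) ⁻¹' unitSource E G ∈ 𝓝 g := by
    have : ContinuousAt (fun h : G ↦ g⁻¹ * h) g :=
      (contMDiff_mul_left (I := 𝓘(ℝ, E)) (n := ∞) (a := g⁻¹)).continuous.continuousAt
    refine this.preimage_mem_nhds ((isOpen_unitSource E G).mem_nhds ?_)
    rw [inv_mul_cancel]; exact one_mem_unitSource E G
  filter_upwards [hs] with h hh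
  simp [unitParam_unitChart hh]

theorem HasLeftDerivAt.mdifferentiableAt {f : G → F} {f' : E →L[ℝ] F} {g : G}
    (hf : HasLeftDerivAt f f' g) : MDifferentiableAt 𝓘(ℝ, E) 𝓘(ℝ, F) f g :=
  hf.hasMFDerivAt.mdifferentiableAt

theorem HasLeftDerivAt.mvfderiv_apply {f : G → F} {f' : E →L[ℝ] F} {g : G}
    (hf : HasLeftDerivAt f f' g) (v : TangentSpace 𝓘(ℝ, E) g) :
    mvfderiv 𝓘(ℝ, E) f g v = f' (leftTriv g v) := by
  rw [mvfderiv, hf.hasMFDerivAt.mfderiv]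
  rfl

/-- The left Maurer–Cartan form in the chart at the identity. -/
def maurerCartan (G : Type*) [TopologicalSpace G] [ChartedSpace E G] [Group G] (y : E) :
    E →L[ℝ] E :=
  fderiv ℝ (fun z : E ↦ unitChart E G ((unitParam G y)⁻¹ * unitParam G z)) y

theorem contDiffAt_leftDiv {y z : E} (hy : y ∈ unitTarget E G) (hz : z ∈ unitTarget E G)
    (h : (unitParam G y)⁻¹ * unitParam G z ∈ unitSource E G) :
    ContDiffAt ℝ ∞
      (fun p : E × E ↦ unitChart E G ((unitParam G p.1)⁻¹ * unitParam G p.2)) (y, z) :=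
  contDiffAt_unitChart_comp
    ((contMDiffAt_unitParam_comp (f := Prod.fst) contDiffAt_fst hy).inv.mul
      (contMDiffAt_unitParam_comp (f := Prod.snd) contDiffAt_snd hz)) h

theorem hasFDerivAt_maurerCartan {y : E} (hy : y ∈ unitTarget E G) :
    HasFDerivAt (fun z : E ↦ unitChart E G ((unitParam G y)⁻¹ * unitParam G z))
      (maurerCartan G y) y := by
  have h : (unitParam G y)⁻¹ * unitParam G y ∈ unitSource E G := by
    rw [inv_mul_cancel]; exact one_mem_unitSource E G
  have h1 := (contDiffAt_leftDiv hy hy h).comp y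
    (contDiffAt_const (c := y) |>.prodMk contDiffAt_id)
  exact (h1.differentiableAt (by simp)).hasFDerivAt

theorem contDiffAt_maurerCartan {y : E} (hy : y ∈ unitTarget E G) :
    ContDiffAt ℝ ∞ (maurerCartan G : E → E →L[ℝ] E) y := by
  have h : (unitParam G y)⁻¹ * unitParam G y ∈ unitSource E G := by
    rw [inv_mul_cancel]; exact one_mem_unitSource E G
  exact ContDiffAt.fderiv
    (f := fun y z : E ↦ unitChart E G ((unitParam G y)⁻¹ * unitParam G z)) (g := id)
    (contDiffAt_leftDiv hy hy h) contDiffAt_id (by simp)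

/-- Chain rule for moving the base point: near y the point `g * unitParam G z` is `g * unitParam G
y` times a small element, whose chart coordinate has derivative `maurerCartan G y`. -/
theorem HasLeftDerivAt.hasFDerivAt_unitParam {f : G → F} {f' : E →L[ℝ] F} {g : G} {y : E}
    (hy : y ∈ unitTarget E G) (hf : HasLeftDerivAt f f' (g * unitParam G y)) :
    HasFDerivAt (fun z : E ↦ f (g * unitParam G z)) (f'.comp (maurerCartan G y)) y := by
  have : IsTopologicalGroup G := topologicalGroup_of_lieGroup 𝓘(ℝ, E) ∞
  have h1 := hasFDerivAt_maurerCartan hy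
  have hpt : unitChart E G ((unitParam G y)⁻¹ * unitParam G y) = unitPt E G := by
    rw [inv_mul_cancel]; rfl
  have h2 : HasFDerivAt (fun w : E ↦ f (g * unitParam G y * unitParam G w)) f'
      (unitChart E G ((unitParam G y)⁻¹ * unitParam G y)) := by
    rw [hpt]; exact hf
  refine (h2.comp y h1).congr_of_eventuallyEq ?_
  have hs : ∀ᶠ z in 𝓝 y, (unitParam G y)⁻¹ * unitParam G z ∈ unitSource E G := by
    refine eventually_mem_unitSource ((continuousAt_unitParam hy).const_mul _) ?_
    rw [inv_mul_cancel]; exact one_mem_unitSource E G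
  filter_upwards [hs] with z hz
  simp only [Function.comp_apply]
  rw [unitParam_unitChart hz, mul_assoc, mul_inv_cancel_left]

/-- Every point has arbitrarily small neighborhoods which are images of balls. -/
theorem image_mem_nhds (g : G) {s : Set E} (hs : s ∈ 𝓝 (unitPt E G)) :
    (fun y ↦ g * unitParam G y) '' s ∈ 𝓝 g := by
  have : IsTopologicalGroup G := topologicalGroup_of_lieGroup 𝓘(ℝ, E) ∞
  have h1 : Filter.Tendsto (fun h : G ↦ unitChart E G (g⁻¹ * h)) (𝓝 g) (𝓝 (unitPt E G)) := by
    have := (hasMFDerivAt_leftTriv (E := E) g).continuousAt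
    rwa [ContinuousAt, inv_mul_cancel] at this
  have h2 : ∀ᶠ h in 𝓝 g, g⁻¹ * h ∈ unitSource E G := by
    have : ContinuousAt (fun h : G ↦ g⁻¹ * h) g := by fun_prop
    refine this.preimage_mem_nhds ((isOpen_unitSource E G).mem_nhds ?_)
    rw [inv_mul_cancel]; exact one_mem_unitSource E G
  filter_upwards [h1.eventually hs, h2] with h hh hh2
  exact ⟨_, hh, by simp [unitParam_unitChart hh2]⟩

theorem tendsto_mul_unitParam (g : G) :
    Filter.Tendsto (fun y : E ↦ g * unitParam G y) (𝓝 (unitPt E G)) (𝓝 g) := by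
  have : IsTopologicalGroup G := topologicalGroup_of_lieGroup 𝓘(ℝ, E) ∞
  have hc : ContinuousAt (fun y : E ↦ g * unitParam G y) (unitPt E G) :=
    (continuousAt_unitParam (unitPt_mem_unitTarget E G)).const_mul g
  simpa [ContinuousAt] using hc

/-- A function whose left derivative vanishes on a connected open set is constant there. -/
theorem eq_of_hasLeftDerivAt_zero {f : G → F} {U : Set G} (hU : IsOpen U)
    (hUc : IsPreconnected U) (hf : ∀ g ∈ U, HasLeftDerivAt f (0 : E →L[ℝ] F) g)
    {g h : G} (hg : g ∈ U) (hh : h ∈ U) : f g = f h := by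
  -- Equality of values is an equivalence relation, so on a preconnected set it suffices to check it
  -- on small images of balls, where the mean value theorem applies.
  refine hUc.induction₂ (fun a b ↦ f a = f b) (fun a ha ↦ ?_) ?_ ?_ hg hh
  · obtain ⟨r, hr, hball⟩ := Metric.mem_nhds_iff.1 (Filter.inter_mem (unitTarget_mem_nhds E G)
      ((tendsto_mul_unitParam (E := E) a).eventually (hU.mem_nhds ha)))
    refine Filter.mem_of_superset (mem_nhdsWithin_of_mem_nhds
      (image_mem_nhds a (Metric.ball_mem_nhds (unitPt E G) hr))) ?_
    rintro _ ⟨y, hy, rfl⟩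
    have h0 : ∀ z ∈ Metric.ball (unitPt E G) r,
        HasFDerivAt (fun z : E ↦ f (a * unitParam G z)) (0 : E →L[ℝ] F) z := fun z hz ↦ by
      simpa using (hf _ (hball hz).2).hasFDerivAt_unitParam (hball hz).1
    have := (convex_ball (unitPt E G) r).is_const_of_fderivWithin_eq_zero (𝕜 := ℝ)
      (f := fun z : E ↦ f (a * unitParam G z))
      (fun z hz ↦ (h0 z hz).differentiableAt.differentiableWithinAt)
      (fun z hz ↦ (h0 z hz).hasFDerivWithinAt.fderivWithin
        (Metric.isOpen_ball.uniqueDiffWithinAt hz)) (Metric.mem_ball_self hr) hy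
    simpa using this
  · intro a b c _ _ _ h1 h2; exact h1.trans h2
  · intro a b _ _ h; exact h.symm

end LeftDerivative

/-! ### The structure constants in the chart at the identity -/

section LocalGroup

variable {E : Type*} [NormedAddCommGroup E] [NormedSpace ℝ E]
  {G : Type*} [TopologicalSpace G] [ChartedSpace E G] [Group G]

variable (G) in
/-- The multiplication of the group, read in the chart at the identity. -/
def mulChart (p : E × E) : E := unitChart E G (unitParam G p.1 * unitParam G p.2)

variable (E G) in
/-- The mixed second derivative of the multiplication at the identity. -/
def mulHess : E →L[ℝ] E →L[ℝ] E :=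
  (fderiv ℝ (fderiv ℝ (mulChart G)) (unitPt E G, unitPt E G)).bilinearComp
    (ContinuousLinearMap.inl ℝ E E) (ContinuousLinearMap.inr ℝ E E)

variable (E G) in
/-- The Lie bracket as a continuous bilinear map on the model space. -/
def bracketCLM : E →L[ℝ] E →L[ℝ] E := mulHess E G - (mulHess E G).flip

theorem bracketCLM_apply (u v : E) :
    bracketCLM E G u v = mulHess E G u v - mulHess E G v u := rfl

theorem bracketCLM_swap (u v : E) : bracketCLM E G u v = -bracketCLM E G v u := by
  simp [bracketCLM_apply]

variable [LieGroup 𝓘(ℝ, E) ∞ G]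

variable (E G) in
theorem contDiffAt_mulChart :
    ContDiffAt ℝ ∞ (mulChart G) (unitPt E G, unitPt E G) := by
  refine contDiffAt_unitChart_comp
    ((contMDiffAt_unitParam_comp (f := Prod.fst) contDiffAt_fst (unitPt_mem_unitTarget E G)).mul
      (contMDiffAt_unitParam_comp (f := Prod.snd) contDiffAt_snd (unitPt_mem_unitTarget E G))) ?_
  simpa using one_mem_unitSource E G

variable (E G) in
theorem eventually_differentiableAt_mulChart :
    ∀ᶠ p in 𝓝 (unitPt E G, unitPt E G), DifferentiableAt ℝ (mulChart G : E × E → E) p := by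
  have h := ((contDiffAt_mulChart E G).of_le (m := 1)
    (WithTop.coe_le_coe.2 (le_top : (1 : ℕ∞) ≤ ⊤))).eventually (by simp)
  filter_upwards [h] with p hp
  exact hp.differentiableAt (by simp)

variable (E G) in
theorem hasFDerivAt_fderiv_mulChart :
    HasFDerivAt (fderiv ℝ (mulChart G : E × E → E))
      (fderiv ℝ (fderiv ℝ (mulChart G)) (unitPt E G, unitPt E G)) (unitPt E G, unitPt E G) :=
  ((contDiffAt_mulChart E G).fderiv_right (m := ∞) (by simp)).differentiableAt (by simp)
    |>.hasFDerivAt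

/-- The differential of left translation by `unitParam G y`, read in the chart. -/
def leftMulChart (G : Type*) [TopologicalSpace G] [ChartedSpace E G] [Group G] (y : E) :
    E →L[ℝ] E :=
  (fderiv ℝ (mulChart G) (y, unitPt E G)).comp (ContinuousLinearMap.inr ℝ E E)

/-- The differential of right translation by `unitParam G y`, read in the chart. -/
def rightMulChart (G : Type*) [TopologicalSpace G] [ChartedSpace E G] [Group G] (y : E) :
    E →L[ℝ] E :=
  (fderiv ℝ (mulChart G) (unitPt E G, y)).comp (ContinuousLinearMap.inl ℝ E E)

variable (E G) in
theorem eventually_hasFDerivAt_leftMulChart : ∀ᶠ y in 𝓝 (unitPt E G),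
    HasFDerivAt (fun z : E ↦ mulChart G (y, z)) (leftMulChart G y) (unitPt E G) := by
  have hc : Filter.Tendsto (fun y : E ↦ (y, unitPt E G)) (𝓝 (unitPt E G))
      (𝓝 (unitPt E G, unitPt E G)) := by
    have : Continuous (fun y : E ↦ (y, unitPt E G)) := by fun_prop
    exact this.tendsto _
  filter_upwards [hc.eventually (eventually_differentiableAt_mulChart E G)] with y hy
  exact hy.hasFDerivAt.comp (unitPt E G) (hasFDerivAt_prodMk_right y (unitPt E G))

variable (E G) in
theorem eventually_hasFDerivAt_rightMulChart : ∀ᶠ y in 𝓝 (unitPt E G),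
    HasFDerivAt (fun z : E ↦ mulChart G (z, y)) (rightMulChart G y) (unitPt E G) := by
  have hc : Filter.Tendsto (fun y : E ↦ (unitPt E G, y)) (𝓝 (unitPt E G))
      (𝓝 (unitPt E G, unitPt E G)) := by
    have : Continuous (fun y : E ↦ (unitPt E G, y)) := by fun_prop
    exact this.tendsto _
  filter_upwards [hc.eventually (eventually_differentiableAt_mulChart E G)] with y hy
  exact HasFDerivAt.comp (f := fun z : E ↦ (z, y)) (unitPt E G) hy.hasFDerivAt
    (hasFDerivAt_prodMk_left (unitPt E G) y)

variable (E G) in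
theorem leftMulChart_unitPt : leftMulChart G (unitPt E G) = ContinuousLinearMap.id ℝ E := by
  refine (eventually_hasFDerivAt_leftMulChart E G).self_of_nhds.unique ?_
  refine (hasFDerivAt_id _).congr_of_eventuallyEq ?_
  filter_upwards [unitTarget_mem_nhds E G] with z hz
  simp [mulChart, unitChart_unitParam hz]

variable (E G) in
theorem hasFDerivAt_leftMulChart :
    HasFDerivAt (leftMulChart G : E → E →L[ℝ] E) (mulHess E G) (unitPt E G) := by
  have h := (HasFDerivAt.comp (f := fun z : E ↦ (z, unitPt E G)) (unitPt E G)
    (hasFDerivAt_fderiv_mulChart E G)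
    (hasFDerivAt_prodMk_left (unitPt E G) (unitPt E G))).clm_comp
    (hasFDerivAt_const (ContinuousLinearMap.inr ℝ E E) (unitPt E G))
  convert! h using 1
  ext u v
  simp [mulHess]

variable (E G) in
-- Symmetry of the second derivative of the multiplication exchanges the two slots; this is why the
-- flip of `mulHess` appears.
theorem hasFDerivAt_rightMulChart :
    HasFDerivAt (rightMulChart G : E → E →L[ℝ] E) (mulHess E G).flip (unitPt E G) := by
  have h := ((hasFDerivAt_fderiv_mulChart E G).comp (unitPt E G)
    (hasFDerivAt_prodMk_right (unitPt E G) (unitPt E G))).clm_comp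
    (hasFDerivAt_const (ContinuousLinearMap.inl ℝ E E) (unitPt E G))
  convert! h using 1
  ext u v
  have hs := ((contDiffAt_mulChart E G).isSymmSndFDerivAt
    (by simpa using WithTop.coe_le_coe.2 (le_top : (2 : ℕ∞) ≤ ⊤))).eq (0, u) (v, 0)
  simpa [mulHess] using hs.symm

/-- Differentiate `unitParam (mulChart (y, z)) = unitParam y * unitParam z` in z at the identity. -/
theorem mpullbackWithin_mulInvariantVectorField (w : GroupLieAlgebra 𝓘(ℝ, E) G) :
    VectorField.mpullbackWithin 𝓘(ℝ, E) 𝓘(ℝ, E) (extChartAt 𝓘(ℝ, E) (1 : G)).symm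
        (mulInvariantVectorField w) (Set.range 𝓘(ℝ, E))
      =ᶠ[𝓝 (unitPt E G)] fun y ↦ leftMulChart G y w := by
  have : IsTopologicalGroup G := topologicalGroup_of_lieGroup 𝓘(ℝ, E) ∞
  filter_upwards [eventually_hasFDerivAt_leftMulChart E G, unitTarget_mem_nhds E G] with y hP hy
  have hinv := isInvertible_mfderivWithin_extChartAt_symm (I := 𝓘(ℝ, E)) (x := (1 : G)) hy
  have hy1 : mulChart G (y, unitPt E G) = y := by simp [mulChart, unitChart_unitParam hy]
  have h1 : HasMFDerivAt 𝓘(ℝ, E) 𝓘(ℝ, E) (unitParam G : E → G) (mulChart G (y, unitPt E G))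
      (mfderiv 𝓘(ℝ, E) 𝓘(ℝ, E) (unitParam G : E → G) y) := by
    rw [hy1]
    exact ((contMDiffAt_unitParam hy).mdifferentiableAt (by simp)).hasMFDerivAt
  have h2 := h1.comp (unitPt E G) hP.hasMFDerivAt
  have h3 : HasMFDerivAt 𝓘(ℝ, E) 𝓘(ℝ, E) (fun h : G ↦ unitParam G y * h)
      (unitParam G (unitPt E G))
      (leftTrans (unitParam G y) : E →L[ℝ] E) := by
    rw [unitParam_unitPt]
    exact ((contMDiff_mul_left (I := 𝓘(ℝ, E)) (n := ∞) (a := unitParam G y)).mdifferentiableAt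
      (by simp)).hasMFDerivAt
  have h4 := h3.comp (unitPt E G) mfderiv_unitParam_unitPt
  have hev : (fun z : E ↦ unitParam G (mulChart G (y, z)))
      =ᶠ[𝓝 (unitPt E G)] fun z ↦ unitParam G y * unitParam G z := by
    have hs : ∀ᶠ z : E in 𝓝 (unitPt E G), unitParam G y * unitParam G z ∈ unitSource E G := by
      refine eventually_mem_unitSource
        ((continuousAt_unitParam (unitPt_mem_unitTarget E G)).const_mul _) ?_
      simpa using unitParam_mem hy
    filter_upwards [hs] with z hz
    exact unitParam_unitChart hz
  have h5 := hasMFDerivAt_unique h2 (h4.congr_of_eventuallyEq hev)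
  have h6 : (mfderivWithin 𝓘(ℝ, E) 𝓘(ℝ, E) (extChartAt 𝓘(ℝ, E) (1 : G)).symm
      (Set.range 𝓘(ℝ, E)) y : E →L[ℝ] E) (leftMulChart G y w)
        = mulInvariantVectorField w ((extChartAt 𝓘(ℝ, E) (1 : G)).symm y) := by
    rw [ModelWithCorners.range_eq_univ, mfderivWithin_univ]
    exact congrArg (fun L : E →L[ℝ] E ↦ L w) h5
  rw [VectorField.mpullbackWithin_apply, ← h6]
  exact hinv.inverse_apply_eq.2 rfl

/-- The Lie bracket in terms of the multiplication in the chart. -/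
theorem lie_eq_bracketCLM (u v : GroupLieAlgebra 𝓘(ℝ, E) G) :
    (⁅u, v⁆ : GroupLieAlgebra 𝓘(ℝ, E) G) = bracketCLM E G u v := by
  -- In the chart the bracket of the left-invariant fields is a commutator of first derivatives at
  -- the identity, and those derivatives are given by `mulHess`.
  have h0 : ∀ a b : E, VectorField.lieBracket ℝ (fun y : E ↦ leftMulChart G y a)
      (fun y ↦ leftMulChart G y b) (unitPt E G) = bracketCLM E G a b := by
    intro a b
    have hd : ∀ w : E, fderiv ℝ (fun y : E ↦ leftMulChart G y w) (unitPt E G)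
        = (mulHess E G).flip w := fun w ↦ by
      rw [((hasFDerivAt_leftMulChart E G).clm_apply (hasFDerivAt_const w _)).fderiv]
      ext; simp
    rw [VectorField.lieBracket_eq]
    simp only [hd, leftMulChart_unitPt]
    rfl
  let V (w : GroupLieAlgebra 𝓘(ℝ, E) G) : E → E :=
    VectorField.mpullbackWithin 𝓘(ℝ, E) 𝓘(ℝ, E) (extChartAt 𝓘(ℝ, E) (1 : G)).symm
        (mulInvariantVectorField w) (Set.range 𝓘(ℝ, E))
  let D : E →L[ℝ] E := mfderiv 𝓘(ℝ, E) 𝓘(ℝ, E) (extChartAt 𝓘(ℝ, E) (1 : G)) 1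
  have hid : D
      = ContinuousLinearMap.id ℝ E := (mfderiv_unitChart_one (E := E) (G := G)).mfderiv
  have hset : (extChartAt 𝓘(ℝ, E) (1 : G)).symm ⁻¹' Set.univ ∩ Set.range 𝓘(ℝ, E) = Set.univ := by
    simp
  have h1 : (⁅u, v⁆ : GroupLieAlgebra 𝓘(ℝ, E) G)
      = D.inverse
        (VectorField.lieBracketWithin ℝ (V u) (V v)
          ((extChartAt 𝓘(ℝ, E) (1 : G)).symm ⁻¹' Set.univ ∩ Set.range 𝓘(ℝ, E))
          (unitPt E G)) := rfl
  have h2 : D.inverse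
        (VectorField.lieBracketWithin ℝ (V u) (V v)
          ((extChartAt 𝓘(ℝ, E) (1 : G)).symm ⁻¹' Set.univ ∩ Set.range 𝓘(ℝ, E))
          (unitPt E G)) = VectorField.lieBracket ℝ (V u) (V v) (unitPt E G) := by
    rw [hset, VectorField.lieBracketWithin_univ]
    rw [hid, ContinuousLinearMap.inverse_id, ContinuousLinearMap.id_apply]
  refine h1.trans (h2.trans (Eq.trans ?_ (h0 u v)))
  exact (mpullbackWithin_mulInvariantVectorField u).lieBracket_vectorField_eq
    (mpullbackWithin_mulInvariantVectorField v)

/-! ### The Maurer–Cartan equation. -/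

variable (E G) in
theorem maurerCartan_unitPt : maurerCartan G (unitPt E G) = ContinuousLinearMap.id ℝ E := by
  refine (hasFDerivAt_maurerCartan (unitPt_mem_unitTarget E G)).unique ?_
  refine (hasFDerivAt_id _).congr_of_eventuallyEq ?_
  filter_upwards [unitTarget_mem_nhds E G] with z hz
  simp [unitChart_unitParam hz]

variable (E G) in
-- The Maurer–Cartan form inverts `leftMulChart`; differentiate their composite, which is the
-- identity, at the identity element.
theorem fderiv_maurerCartan_unitPt :
    fderiv ℝ (maurerCartan G : E → E →L[ℝ] E) (unitPt E G) = -mulHess E G := by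
  have hM := ((contDiffAt_maurerCartan (unitPt_mem_unitTarget E G)).differentiableAt
    (by simp)).hasFDerivAt
  have h1 := (hasFDerivAt_leftMulChart E G).clm_comp hM
  have hev : (fun y : E ↦ (leftMulChart G y).comp (maurerCartan G y))
      =ᶠ[𝓝 (unitPt E G)] fun _ ↦ ContinuousLinearMap.id ℝ E := by
    filter_upwards [eventually_hasFDerivAt_leftMulChart E G, unitTarget_mem_nhds E G] with y hP hy
    have hpt : unitChart E G ((unitParam G y)⁻¹ * unitParam G y) = unitPt E G := by
      rw [inv_mul_cancel]; rfl
    have h2 := HasFDerivAt.comp (g := fun z : E ↦ mulChart G (y, z)) y (hpt ▸ hP)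
      (hasFDerivAt_maurerCartan hy)
    refine h2.unique ((hasFDerivAt_id _).congr_of_eventuallyEq ?_)
    have hs : ∀ᶠ z in 𝓝 y, (unitParam G y)⁻¹ * unitParam G z ∈ unitSource E G := by
      have : IsTopologicalGroup G := topologicalGroup_of_lieGroup 𝓘(ℝ, E) ∞
      refine eventually_mem_unitSource ((continuousAt_unitParam hy).const_mul _) ?_
      rw [inv_mul_cancel]; exact one_mem_unitSource E G
    filter_upwards [hs, (isOpen_unitTarget E G).mem_nhds hy] with z hz hz'
    simp [mulChart, unitParam_unitChart hz, unitChart_unitParam hz']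
  have h3 := h1.unique ((hasFDerivAt_const _ _).congr_of_eventuallyEq hev)
  rw [leftMulChart_unitPt, maurerCartan_unitPt] at h3
  ext b c
  have := congrArg (fun L : E →L[ℝ] E →L[ℝ] E ↦ L b c) h3
  simp at this
  simpa using eq_neg_of_add_eq_zero_left this

/-- This is the Maurer–Cartan equation dθ = -[θ, θ]. By left invariance θ is its own pullback under
the translation τ taking y to the identity, where dθ is known; the second derivative of τ is
symmetric and drops out. -/
theorem fderiv_maurerCartan_sub {y : E} (hy : y ∈ unitTarget E G) (b c : E) :
    fderiv ℝ (maurerCartan G : E → E →L[ℝ] E) y b c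
      - fderiv ℝ (maurerCartan G : E → E →L[ℝ] E) y c b
      = -bracketCLM E G (maurerCartan G y b) (maurerCartan G y c) := by
  have : IsTopologicalGroup G := topologicalGroup_of_lieGroup 𝓘(ℝ, E) ∞
  set τ : E → E := fun z ↦ unitChart E G ((unitParam G y)⁻¹ * unitParam G z) with hτ
  have hyy : (unitParam G y)⁻¹ * unitParam G y ∈ unitSource E G := by
    rw [inv_mul_cancel]; exact one_mem_unitSource E G
  have hτy : τ y = unitPt E G := by simp only [hτ, inv_mul_cancel]; rfl
  have hτs : ContDiffAt ℝ ∞ τ y :=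
    (contDiffAt_leftDiv hy hy hyy).comp y (contDiffAt_const (c := y) |>.prodMk contDiffAt_id)
  have hdτ : fderiv ℝ τ y = maurerCartan G y := rfl
  have hs : ∀ᶠ z in 𝓝 y, (unitParam G y)⁻¹ * unitParam G z ∈ unitSource E G :=
    eventually_mem_unitSource ((continuousAt_unitParam hy).const_mul _) hyy
  have hdiff : ∀ᶠ z in 𝓝 y, DifferentiableAt ℝ τ z := by
    have h := (hτs.of_le (m := 1)
      (WithTop.coe_le_coe.2 (le_top : (1 : ℕ∞) ≤ ⊤))).eventually (by simp)
    filter_upwards [h] with p hp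
    exact hp.differentiableAt (by simp)
  have hev : (maurerCartan G : E → E →L[ℝ] E)
      =ᶠ[𝓝 y] fun z ↦ (maurerCartan G (τ z)).comp (fderiv ℝ τ z) := by
    filter_upwards [hs, hs.eventually_nhds, hdiff, (isOpen_unitTarget E G).mem_nhds hy]
      with z hz hz2 hz3 hz4
    have h1 := (hasFDerivAt_maurerCartan (unitChart_mem hz)).comp z hz3.hasFDerivAt
    refine (hasFDerivAt_maurerCartan hz4).unique (h1.congr_of_eventuallyEq ?_)
    filter_upwards [hz2] with w hw
    simp only [Function.comp_apply, hτ]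
    rw [unitParam_unitChart hz, unitParam_unitChart hw]
    congr 1
    group
  have hM : HasFDerivAt (maurerCartan G : E → E →L[ℝ] E) (-mulHess E G) (τ y) := by
    rw [hτy, ← fderiv_maurerCartan_unitPt]
    exact ((contDiffAt_maurerCartan (unitPt_mem_unitTarget E G)).differentiableAt
      (by simp)).hasFDerivAt
  have hD : HasFDerivAt (fderiv ℝ τ) (fderiv ℝ (fderiv ℝ τ) y) y :=
    ((hτs.fderiv_right (m := ∞) (by simp)).differentiableAt (by simp)).hasFDerivAt
  have h2 := (hM.comp y ((hdiff.self_of_nhds).hasFDerivAt)).clm_comp hD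
  rw [(h2.congr_of_eventuallyEq hev).fderiv]
  have hsymm := (hτs.isSymmSndFDerivAt
    (by simpa using WithTop.coe_le_coe.2 (le_top : (2 : ℕ∞) ≤ ⊤))).eq b c
  simp [hτy, maurerCartan_unitPt, hdτ, bracketCLM_apply, hsymm]
  abel

/-! ### The adjoint representation and its derivative. -/

variable (E) in
/-- The linear map `Ad g⁻¹` on the model space. -/
def adInv (g : G) : E →L[ℝ] E := Ad E g⁻¹

theorem hasFDerivAt_adInv (g : G) :
    HasFDerivAt (fun z : E ↦ unitChart E G (g⁻¹ * unitParam G z * g)) (adInv E g)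
      (unitPt E G) := by
  have : IsTopologicalGroup G := topologicalGroup_of_lieGroup 𝓘(ℝ, E) ∞
  have hconj : MDifferentiableAt 𝓘(ℝ, E) 𝓘(ℝ, E) (fun h : G ↦ g⁻¹ * h * g⁻¹⁻¹) 1 :=
    ((contMDiff_const.mul contMDiff_id).mul contMDiff_const :
      ContMDiff 𝓘(ℝ, E) 𝓘(ℝ, E) ∞ (fun h : G ↦ g⁻¹ * h * g⁻¹⁻¹)).mdifferentiableAt (by simp)
  have h1 : HasMFDerivAt 𝓘(ℝ, E) 𝓘(ℝ, E) (fun h : G ↦ g⁻¹ * h * g⁻¹⁻¹)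
      (unitParam G (unitPt E G)) (adInv E g) := by
    rw [unitParam_unitPt]; exact hconj.hasMFDerivAt
  have h2 := h1.comp (unitPt E G) (mfderiv_unitParam_unitPt (E := E) (G := G))
  have h3 : HasMFDerivAt 𝓘(ℝ, E) 𝓘(ℝ, E) (unitChart E G)
      (g⁻¹ * unitParam G (unitPt E G) * g⁻¹⁻¹) (ContinuousLinearMap.id ℝ E) := by
    rw [unitParam_unitPt, mul_one, mul_inv_cancel]; exact mfderiv_unitChart_one
  have h4 := h3.comp (unitPt E G) h2
  simpa using! h4.hasFDerivAt

variable (E G) in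
theorem adInv_one : adInv E (1 : G) = ContinuousLinearMap.id ℝ E := by
  refine (hasFDerivAt_adInv (1 : G)).unique ((hasFDerivAt_id _).congr_of_eventuallyEq ?_)
  filter_upwards [unitTarget_mem_nhds E G] with z hz
  simp [unitChart_unitParam hz]

theorem adInv_mul (g h : G) : adInv E (g * h) = (adInv E h).comp (adInv E g) := by
  have : IsTopologicalGroup G := topologicalGroup_of_lieGroup 𝓘(ℝ, E) ∞
  have hpt : unitChart E G (g⁻¹ * unitParam G (unitPt E G) * g) = unitPt E G := by
    rw [unitParam_unitPt]; simp; rfl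
  have h1 := HasFDerivAt.comp (g := fun z : E ↦ unitChart E G (h⁻¹ * unitParam G z * h))
    (unitPt E G) (hpt.symm ▸ hasFDerivAt_adInv h) (hasFDerivAt_adInv g)
  refine (hasFDerivAt_adInv (g * h)).unique (h1.congr_of_eventuallyEq ?_)
  have hs : ∀ᶠ z : E in 𝓝 (unitPt E G), g⁻¹ * unitParam G z * g ∈ unitSource E G := by
    refine eventually_mem_unitSource
      (((continuousAt_unitParam (unitPt_mem_unitTarget E G)).const_mul _).mul_const _) ?_
    simpa using one_mem_unitSource E G
  filter_upwards [hs] with z hz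
  simp only [Function.comp_apply]
  rw [unitParam_unitChart hz]
  congr 1
  group

/-- Conjugation by g⁻¹ is right translation by g followed by left translation by g⁻¹. Through this
identity `adInv` stands for right-invariant fields everywhere below. -/
theorem leftTriv_rightInvariantField (u : GroupLieAlgebra 𝓘(ℝ, E) G) (g : G) :
    leftTriv g (rightInvariantField u g) = adInv E g u := by
  have h1 : HasMFDerivAt 𝓘(ℝ, E) 𝓘(ℝ, E) (fun x : G ↦ x * g) 1
      (mfderiv 𝓘(ℝ, E) 𝓘(ℝ, E) (fun x : G ↦ x * g) 1) :=
    ((contMDiff_mul_right (I := 𝓘(ℝ, E)) (n := ∞) (a := g)).mdifferentiableAt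
      (by simp)).hasMFDerivAt
  have h2 : HasMFDerivAt 𝓘(ℝ, E) 𝓘(ℝ, E) (fun x : G ↦ g⁻¹ * x) (1 * g)
      (leftTriv g : E →L[ℝ] E) := by
    rw [one_mul]
    exact ((contMDiff_mul_left (I := 𝓘(ℝ, E)) (n := ∞) (a := g⁻¹)).mdifferentiableAt
      (by simp)).hasMFDerivAt
  have h3 := (h2.comp 1 h1).mfderiv
  have h4 : adInv E g = mfderiv 𝓘(ℝ, E) 𝓘(ℝ, E) (fun h : G ↦ g⁻¹ * h * g⁻¹⁻¹) 1 := rfl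
  have h5 : (fun h : G ↦ g⁻¹ * h * g⁻¹⁻¹) = (fun x : G ↦ g⁻¹ * x) ∘ (fun x : G ↦ x * g) := by
    ext x; simp [mul_assoc]
  rw [h4, h5]
  exact (congrArg (fun L : E →L[ℝ] E ↦ L u) h3).symm

theorem contDiffAt_adInv_unitParam {y : E} (hy : y ∈ unitTarget E G) :
    ContDiffAt ℝ ∞ (fun y : E ↦ adInv E (unitParam G y)) y := by
  have hT : ContDiffAt ℝ ∞ (Function.uncurry fun y z : E ↦
      unitChart E G ((unitParam G y)⁻¹ * unitParam G z * unitParam G y)) (y, unitPt E G) := by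
    have h1 := contMDiffAt_unitParam_comp (G := G) (f := (Prod.fst : E × E → E))
      (p := (y, unitPt E G)) contDiffAt_fst hy
    have h2 := contMDiffAt_unitParam_comp (G := G) (f := (Prod.snd : E × E → E))
      (p := (y, unitPt E G)) contDiffAt_snd (unitPt_mem_unitTarget E G)
    refine contDiffAt_unitChart_comp ((h1.inv.mul h2).mul h1) ?_
    simpa using one_mem_unitSource E G
  have hA : ∀ y : E, fderiv ℝ (fun z : E ↦
      unitChart E G ((unitParam G y)⁻¹ * unitParam G z * unitParam G y)) (unitPt E G)
        = adInv E (unitParam G y) := fun y ↦ (hasFDerivAt_adInv _).fderiv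
  have := ContDiffAt.fderiv (m := ∞) (g := fun _ : E ↦ unitPt E G) hT contDiffAt_const (by simp)
  simpa only [hA] using this

variable (E G) in
-- Left translation by y composed with Ad y⁻¹ is right translation by y. Differentiating in y, the
-- derivative of Ad y⁻¹ at the identity is the flip of `mulHess` minus `mulHess`.
theorem hasFDerivAt_adInv_unitParam :
    HasFDerivAt (fun y : E ↦ adInv E (unitParam G y)) (-bracketCLM E G) (unitPt E G) := by
  have : IsTopologicalGroup G := topologicalGroup_of_lieGroup 𝓘(ℝ, E) ∞
  have hd : DifferentiableAt ℝ (fun y : E ↦ adInv E (unitParam G y)) (unitPt E G) :=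
    (contDiffAt_adInv_unitParam (unitPt_mem_unitTarget E G)).differentiableAt (by simp)
  have h1 := (hasFDerivAt_leftMulChart E G).clm_comp hd.hasFDerivAt
  have hev : (fun y : E ↦ (leftMulChart G y).comp (adInv E (unitParam G y)))
      =ᶠ[𝓝 (unitPt E G)] rightMulChart G := by
    filter_upwards [eventually_hasFDerivAt_leftMulChart E G,
      eventually_hasFDerivAt_rightMulChart E G] with y hP hQ
    have hpt : unitChart E G ((unitParam G y)⁻¹ * unitParam G (unitPt E G) * unitParam G y)
        = unitPt E G := by rw [unitParam_unitPt]; simp; rfl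
    have h2 := HasFDerivAt.comp (g := fun z : E ↦ mulChart G (y, z)) (unitPt E G)
      (hpt.symm ▸ hP) (hasFDerivAt_adInv (unitParam G y))
    refine h2.unique (hQ.congr_of_eventuallyEq ?_)
    have hs : ∀ᶠ z : E in 𝓝 (unitPt E G),
        (unitParam G y)⁻¹ * unitParam G z * unitParam G y ∈ unitSource E G := by
      refine eventually_mem_unitSource
        (((continuousAt_unitParam (unitPt_mem_unitTarget E G)).const_mul _).mul_const _) ?_
      simpa using one_mem_unitSource E G
    filter_upwards [hs] with z hz
    simp only [Function.comp_apply, mulChart]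
    rw [unitParam_unitChart hz]
    congr 1
    group
  have h3 := (h1.congr_of_eventuallyEq hev.symm).unique (hasFDerivAt_rightMulChart E G)
  rw [leftMulChart_unitPt, unitParam_unitPt, adInv_one] at h3
  convert! hd.hasFDerivAt using 1
  ext b c
  have := congrArg (fun L : E →L[ℝ] E →L[ℝ] E ↦ L b c) h3
  simp at this
  simp [bracketCLM_apply, ← this]

theorem hasLeftDerivAt_adInv (g : G) :
    HasLeftDerivAt (adInv E : G → E →L[ℝ] E)
      (-((ContinuousLinearMap.compL ℝ E E E).flip (adInv E g)).comp (bracketCLM E G)) g := by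
  have h := ((ContinuousLinearMap.compL ℝ E E E).flip (adInv E g)).hasFDerivAt.comp (unitPt E G)
    (hasFDerivAt_adInv_unitParam E G)
  refine HasFDerivAt.congr_of_eventuallyEq (h.congr_fderiv ?_) (Filter.Eventually.of_forall ?_)
  · ext b c; simp
  · intro y; simp [adInv_mul]

theorem hasLeftDerivAt_adInv_apply (g : G) (u : E) :
    HasLeftDerivAt (fun h : G ↦ adInv E h u) (-(bracketCLM E G).flip (adInv E g u)) g := by
  refine (HasFDerivAt.clm_apply (hasLeftDerivAt_adInv g) (hasFDerivAt_const u _)).congr_fderiv ?_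
  ext b; simp

theorem hasLeftDerivAt_adInv_inv (g : G) :
    HasLeftDerivAt (fun h : G ↦ adInv E h⁻¹)
      ((ContinuousLinearMap.compL ℝ E E E (adInv E g⁻¹)).comp (bracketCLM E G)) g := by
  have h0 : MDifferentiableAt 𝓘(ℝ, E) 𝓘(ℝ, E →L[ℝ] E) (fun h : G ↦ adInv E h⁻¹) 1 := by
    have hi : MDifferentiableAt 𝓘(ℝ, E) 𝓘(ℝ, E) (fun h : G ↦ h⁻¹) 1 :=
      (contMDiff_inv 𝓘(ℝ, E) ∞).mdifferentiableAt (by simp)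
    exact (hasLeftDerivAt_adInv (E := E) (1 : G)⁻¹).mdifferentiableAt.comp 1 hi
  obtain ⟨f', hf'⟩ := exists_hasLeftDerivAt h0
  have h1 : HasFDerivAt (fun y : E ↦ adInv E (unitParam G y)⁻¹) f' (unitPt E G) := by
    simpa [HasLeftDerivAt] using hf'
  have h2 := (hasFDerivAt_adInv_unitParam E G).clm_comp h1
  have h3 : ∀ y : E, (adInv E (unitParam G y)).comp (adInv E (unitParam G y)⁻¹)
      = ContinuousLinearMap.id ℝ E := fun y ↦ by
    rw [← adInv_mul, inv_mul_cancel, adInv_one]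
  simp only [h3] at h2
  have h4 := h2.unique (hasFDerivAt_const _ _)
  have h5 : f' = bracketCLM E G := by
    ext b c
    have := congrArg (fun L : E →L[ℝ] E →L[ℝ] E ↦ L b c) h4
    simp only [unitParam_unitPt, inv_one, adInv_one] at this
    simp at this
    simpa using eq_neg_of_add_eq_zero_left this
  have h6 := (ContinuousLinearMap.compL ℝ E E E (adInv E g⁻¹)).hasFDerivAt.comp (unitPt E G) h1
  refine HasFDerivAt.congr_of_eventuallyEq (h6.congr_fderiv ?_) (Filter.Eventually.of_forall ?_)
  · rw [h5]
  · intro y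
    simp [adInv_mul]

end LocalGroup

/-! ### Parallel one-forms and the form `Ω` on the model space -/

section ParallelSections

variable {E : Type*} [NormedAddCommGroup E] [NormedSpace ℝ E]
  {G : Type*} [TopologicalSpace G] [ChartedSpace E G] [Group G] [LieGroup 𝓘(ℝ, E) ∞ G]

/-- The sections `b : G → L` with `db = -[·, b]` on a connected open set are the functions
`g ↦ Ad g⁻¹ c` with `c` constant. -/
theorem exists_eq_adInv {U : Set G} (hU : IsOpen U) (hUc : IsPreconnected U) {b : G → E}
    (hb : ∀ g ∈ U, HasLeftDerivAt b (-(bracketCLM E G).flip (b g)) g) :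
    ∃ c : E, ∀ g ∈ U, b g = adInv E g c := by
  have hinv : ∀ g : G, ∀ u : E, adInv E g (adInv E g⁻¹ u) = u := fun g u ↦ by
    have := adInv_mul (E := E) g⁻¹ g
    rw [inv_mul_cancel, adInv_one] at this
    exact (congrArg (fun L : E →L[ℝ] E ↦ L u) this).symm
  have h0 : ∀ g ∈ U, HasLeftDerivAt (fun h ↦ adInv E h⁻¹ (b h)) (0 : E →L[ℝ] E) g := by
    intro g hg
    have h := HasFDerivAt.clm_apply (hasLeftDerivAt_adInv_inv (E := E) g) (hb g hg)
    refine HasFDerivAt.congr_fderiv h ?_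
    ext v
    simp
  obtain rfl | ⟨g₀, hg₀⟩ := U.eq_empty_or_nonempty
  · exact ⟨0, by simp⟩
  · refine ⟨adInv E g₀⁻¹ (b g₀), fun g hg ↦ ?_⟩
    rw [eq_of_hasLeftDerivAt_zero hU hUc h0 hg₀ hg, hinv]

/-- The bracket reached through the Lie ring structure, the form in which Lie algebra identities and
the cocycle identity present it to rewriting. -/
theorem lie_eq_bracketCLM' [CompleteSpace E] (u v : GroupLieAlgebra 𝓘(ℝ, E) G) :
    LieRing.toBracket.bracket u v = bracketCLM E G u v := lie_eq_bracketCLM u v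

theorem bracketCLM_jacobi [CompleteSpace E] (u v w : E) :
    bracketCLM E G u (bracketCLM E G v w)
      = bracketCLM E G (bracketCLM E G u v) w + bracketCLM E G v (bracketCLM E G u w) := by
  have key : ∀ u v w : GroupLieAlgebra 𝓘(ℝ, E) G, bracketCLM E G u (bracketCLM E G v w)
      = bracketCLM E G (bracketCLM E G u v) w + bracketCLM E G v (bracketCLM E G u w) := by
    intro u v w
    have h := leibniz_lie u v w
    rw [lie_eq_bracketCLM' v w, lie_eq_bracketCLM' u v, lie_eq_bracketCLM' u w] at h
    exact (lie_eq_bracketCLM' u _).symm.trans (h.trans (congrArg₂ (fun a b : E ↦ a + b)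
      (lie_eq_bracketCLM' _ w) (lie_eq_bracketCLM' v _)))
  exact key u v w

/-- The maps `Ad g⁻¹` are automorphisms of the Lie algebra. -/
theorem adInv_bracketCLM [CompleteSpace E] [ConnectedSpace G] (g : G) (u v : E) :
    adInv E g (bracketCLM E G u v) = bracketCLM E G (adInv E g u) (adInv E g v) := by
  -- By the Jacobi identity, h ↦ [Ad h⁻¹ u, Ad h⁻¹ v] solves the equation db = -[·, b], so it is h ↦
  -- Ad h⁻¹ c; evaluation at 1 identifies c. Connectedness of G makes this valid everywhere.
  obtain ⟨c, hc⟩ := exists_eq_adInv (U := (Set.univ : Set G)) isOpen_univ isPreconnected_univ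
    (b := fun h ↦ bracketCLM E G (adInv E h u) (adInv E h v)) (fun h _ ↦ by
      have h1 := ((bracketCLM E G).hasFDerivAt.comp (unitPt E G)
        (hasLeftDerivAt_adInv_apply h u)).clm_apply (hasLeftDerivAt_adInv_apply h v)
      refine HasFDerivAt.congr_fderiv h1 ?_
      ext w
      simp [bracketCLM_jacobi w])
  have h1 := hc 1 trivial
  simp only [adInv_one, ContinuousLinearMap.id_apply] at h1
  rw [h1, ← hc g trivial]

end ParallelSections

/-! ### The cocycle, the product and the musical isomorphism on the model space. -/

section FormOnModel

variable {E : Type*} [NormedAddCommGroup E] [NormedSpace ℝ E] [FiniteDimensional ℝ E]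
  {G : Type*} [TopologicalSpace G] [ChartedSpace E G] [Group G] [LieGroup 𝓘(ℝ, E) ∞ G]
  (Ω : SymplecticCocycle (GroupLieAlgebra 𝓘(ℝ, E) G))

/-- The form `Ω` as a continuous bilinear form on the model space. -/
def formCLM : E →L[ℝ] E →L[ℝ] ℝ :=
  LinearMap.toContinuousBilinearMap (E := E) (F := E) (G := ℝ) Ω.form

/-- The product of the Lie algebra as a continuous bilinear map on the model space. -/
def productCLM : E →L[ℝ] E →L[ℝ] E :=
  LinearMap.toContinuousBilinearMap (E := E) (F := E) (G := E) Ω.product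

/-- The inverse of `v ↦ Ω(v, ·)` on the model space. -/
def sharpCLM : (E →L[ℝ] ℝ) →L[ℝ] E :=
  LinearMap.toContinuousLinearMap
    ((Ω.sharp.toLinearMap : Module.Dual ℝ E →ₗ[ℝ] E).comp (ContinuousLinearMap.coeLM ℝ))

theorem formCLM_swap (u v : E) : formCLM Ω u v = -formCLM Ω v u :=
  (Ω.alt.neg_eq v u).symm

theorem formCLM_sharpCLM (β : E →L[ℝ] ℝ) : formCLM Ω (sharpCLM Ω β) = β := by
  ext v
  exact LinearMap.BilinForm.apply_toDual_symm_apply (hB := Ω.nondegenerate) (β : Module.Dual ℝ E) v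

theorem formCLM_injective : Function.Injective (formCLM Ω) := by
  intro u v h
  have h1 : Ω.form.toDual Ω.nondegenerate u = Ω.form.toDual Ω.nondegenerate v :=
    LinearMap.ext fun w ↦ congrArg (fun L : E →L[ℝ] ℝ ↦ L w) h
  exact (Ω.form.toDual Ω.nondegenerate).injective h1

theorem sharpCLM_formCLM (u : E) : sharpCLM Ω (formCLM Ω u) = u :=
  formCLM_injective Ω (formCLM_sharpCLM Ω _)

theorem formCLM_cocycle (u v w : E) :
    formCLM Ω (bracketCLM E G u v) w + formCLM Ω (bracketCLM E G v w) u
      + formCLM Ω (bracketCLM E G w u) v = 0 := by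
  have key : ∀ u v w : GroupLieAlgebra 𝓘(ℝ, E) G, formCLM Ω (bracketCLM E G u v) w
      + formCLM Ω (bracketCLM E G v w) u + formCLM Ω (bracketCLM E G w u) v = 0 := by
    intro u v w
    have h := Ω.cocycle u v w
    rw [lie_eq_bracketCLM', lie_eq_bracketCLM', lie_eq_bracketCLM'] at h
    exact h
  exact key u v w

theorem formCLM_productCLM (u v w : E) :
    formCLM Ω (productCLM Ω u v) w = -formCLM Ω v (bracketCLM E G u w) := by
  have key : ∀ u v w : GroupLieAlgebra 𝓘(ℝ, E) G,
      formCLM Ω (productCLM Ω u v) w = -formCLM Ω v (bracketCLM E G u w) := by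
    intro u v w
    have h := Ω.form_product u v w
    rw [lie_eq_bracketCLM'] at h
    exact h
  exact key u v w

theorem formCLM_productCLM_right (a u v : E) :
    formCLM Ω a (productCLM Ω u v) = -formCLM Ω (bracketCLM E G u a) v := by
  rw [formCLM_swap, formCLM_productCLM, neg_neg, formCLM_swap]

/-- The functions `Ω⁺(u⁻, v⁻)` have differential `i_{[u, v]⁻} Ω⁺`. -/
theorem hasLeftDerivAt_formCLM_adInv [ConnectedSpace G] (u v : E) (g : G) :
    HasLeftDerivAt (fun h ↦ formCLM Ω (adInv E h u) (adInv E h v))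
      (formCLM Ω (adInv E g (bracketCLM E G u v))) g := by
  have : CompleteSpace E := FiniteDimensional.complete ℝ E
  have h1 := ((formCLM Ω).hasFDerivAt.comp (unitPt E G)
    (hasLeftDerivAt_adInv_apply g u)).clm_apply (hasLeftDerivAt_adInv_apply g v)
  refine HasFDerivAt.congr_fderiv h1 ?_
  ext w
  -- The product rule gives -Ω([w, a], b) - Ω(a, [w, b]) with a = Ad g⁻¹ u and b = Ad g⁻¹ v; the
  -- cocycle identity turns it into Ω([a, b], w).
  have h := formCLM_cocycle Ω (adInv E g u) (adInv E g v) w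
  rw [formCLM_swap Ω (bracketCLM E G (adInv E g v) w), bracketCLM_swap (adInv E g v) w] at h
  simp [adInv_bracketCLM] at h ⊢
  linarith

end FormOnModel

/-! ### Affine charts -/

theorem Chart.dcoord_coordVec {E : Type*} [NormedAddCommGroup E] [NormedSpace ℝ E]
    {G : Type*} [TopologicalSpace G] [ChartedSpace E G] {n : ℕ} (x : Chart E G n) (i j : Fin n)
    {g : G} (hg : g ∈ x.source) :
    x.dcoord i g (x.coordVec j g) = if i = j then 1 else 0 := by
  have h1 : MDifferentiableAt 𝓘(ℝ, E) 𝓘(ℝ, Fin n → ℝ) x g := x.mdifferentiableAt (by simp) hg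
  have hgt : x g ∈ x.target := x.map_source hg
  have h2 : MDifferentiableAt 𝓘(ℝ, Fin n → ℝ) 𝓘(ℝ, E) x.invFun (x g) :=
    x.symm.mdifferentiableAt (by simp) hgt
  have h3 : MDifferentiableAt 𝓘(ℝ, E) 𝓘(ℝ, ℝ) (x.coord i) g :=
    (ContinuousLinearMap.proj (R := ℝ) (φ := fun _ : Fin n ↦ ℝ)
      i).differentiableAt.mdifferentiableAt.comp g h1
  have h4 : HasMFDerivAt 𝓘(ℝ, E) 𝓘(ℝ, ℝ) (x.coord i) (x.invFun (x g))
      (mvfderiv 𝓘(ℝ, E) (x.coord i) g : E →L[ℝ] ℝ) := by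
    have : x.invFun (x g) = g := x.left_inv hg
    rw [this]
    exact h3.hasMFDerivAt
  let D : (Fin n → ℝ) →L[ℝ] ℝ := (mvfderiv 𝓘(ℝ, E) (x.coord i) g : E →L[ℝ] ℝ).comp
    (mfderiv 𝓘(ℝ, Fin n → ℝ) 𝓘(ℝ, E) x.invFun (x g) : (Fin n → ℝ) →L[ℝ] E)
  let f : (Fin n → ℝ) → ℝ := x.coord i ∘ x.invFun
  have h5 : HasFDerivAt f D (x g) := (h4.comp (x g) h2.hasMFDerivAt).hasFDerivAt
  let p : (Fin n → ℝ) →L[ℝ] ℝ := ContinuousLinearMap.proj i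
  have h6 : f =ᶠ[𝓝 (x g)] p := by
    filter_upwards [x.open_target.mem_nhds hgt] with y hy
    exact congrFun (x.right_inv hy) i
  have h7 : D = p := h5.unique (p.hasFDerivAt.congr_of_eventuallyEq h6)
  have h8 := congrArg (fun L : (Fin n → ℝ) →L[ℝ] ℝ ↦ L (Pi.single j 1)) h7
  exact h8.trans (Pi.single_apply j (1 : ℝ) i)

/-- In finite dimension a linear map is the sum of its values on a basis tensored with the dual
basis. Parallelism is tested one vector field at a time, so it gives only the derivatives of the
evaluations. -/
theorem HasLeftDerivAt.clm_of_apply {E : Type*} [NormedAddCommGroup E] [NormedSpace ℝ E]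
    [FiniteDimensional ℝ E] {G : Type*} [TopologicalSpace G] [ChartedSpace E G] [Group G]
    {F : Type*} [NormedAddCommGroup F] [NormedSpace ℝ F]
    {β : G → E →L[ℝ] F} {g : G} {β' : E →L[ℝ] E →L[ℝ] F}
    (h : ∀ η, HasLeftDerivAt (fun h ↦ β h η) (β'.flip η) g) : HasLeftDerivAt β β' g := by
  let e := Module.finBasis ℝ E
  let ε : Fin (Module.finrank ℝ E) → E →L[ℝ] ℝ := fun j ↦
    LinearMap.toContinuousLinearMap (e.coord j)
  have hsum : ∀ L : E →L[ℝ] F, L = ∑ j, (ContinuousLinearMap.smulRightL ℝ E F (ε j)) (L (e j)) := by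
    intro L
    ext v
    conv_lhs => rw [← e.sum_repr v, map_sum]
    simp [ε]
  have h1 : HasFDerivAt (fun y : E ↦ ∑ j, (ContinuousLinearMap.smulRightL ℝ E F (ε j))
      (β (g * unitParam G y) (e j))) (∑ j, (ContinuousLinearMap.smulRightL ℝ E F (ε j)).comp
        (β'.flip (e j))) (unitPt E G) :=
    HasFDerivAt.fun_sum fun j _ ↦
      (ContinuousLinearMap.smulRightL ℝ E F (ε j)).hasFDerivAt.comp (unitPt E G) (h (e j))
  refine HasFDerivAt.congr_of_eventuallyEq (h1.congr_fderiv ?_)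
    (Filter.Eventually.of_forall fun y ↦ hsum _)
  ext1 ξ
  rw [hsum (β' ξ)]
  simp

section AffineCharts

variable {E : Type*} [NormedAddCommGroup E] [NormedSpace ℝ E]
  {G : Type*} [TopologicalSpace G] [ChartedSpace E G] [Group G] [LieGroup 𝓘(ℝ, E) ∞ G]

theorem leftTriv_leftTrans' (g : G) (v : E) :
    (leftTriv g : E →L[ℝ] E) ((leftTrans g : E →L[ℝ] E) v) = v := leftTriv_leftTrans g v

theorem leftTrans_leftTriv' (g : G) (v : E) :
    (leftTrans g : E →L[ℝ] E) ((leftTriv g : E →L[ℝ] E) v) = v := leftTrans_leftTriv g v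

variable [FiniteDimensional ℝ E]
  (Ω : SymplecticCocycle (GroupLieAlgebra 𝓘(ℝ, E) G))

/-- The covariant derivative in the left-invariant trivialization. -/
theorem leftTriv_connection {Y : (g : G) → TangentSpace 𝓘(ℝ, E) g} {g : G} {F' : E →L[ℝ] E}
    (hF : HasLeftDerivAt (leftCoord Y) F' g) (v : TangentSpace 𝓘(ℝ, E) g) :
    (leftTriv g (connection Ω Y g v) : E)
      = F' (leftTriv g v) + productCLM Ω (leftTriv g v) (leftCoord Y g) := by
  have h := connectionFun_apply Ω Y g v _ (hF.mvfderiv_apply v)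
  exact (congrArg (leftTriv g) h).trans (leftTriv_leftTrans g _)

theorem leftTriv_connection_mulInvariantVectorField (η : GroupLieAlgebra 𝓘(ℝ, E) G) (g : G)
    (v : TangentSpace 𝓘(ℝ, E) g) :
    (leftTriv g (connection Ω (mulInvariantVectorField η) g v) : E)
      = productCLM Ω (leftTriv g v) η := by
  have h0 : leftCoord (mulInvariantVectorField η : (g : G) → TangentSpace 𝓘(ℝ, E) g)
      = fun _ ↦ η := funext fun h ↦ leftTriv_leftTrans h η
  have h1 : HasLeftDerivAt (leftCoord (mulInvariantVectorField η :
      (g : G) → TangentSpace 𝓘(ℝ, E) g)) (0 : E →L[ℝ] E) g := by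
    rw [h0]; exact hasFDerivAt_const _ _
  refine (leftTriv_connection Ω h1 v).trans ?_
  rw [h0]
  exact zero_add _

variable {n : ℕ}

/-- The coordinate functions of an affine chart with connected domain have differentials
`i_{c⁻} Ω⁺`. -/
theorem Chart.IsAffine.exists_dcoord_eq {x : Chart E G n} (hx : x.IsAffine (connection Ω))
    (hc : IsPreconnected x.source) : ∃ c : Fin n → E, ∀ i, ∀ g ∈ x.source,
      ∀ v : TangentSpace 𝓘(ℝ, E) g,
        x.dcoord i g v = formCLM Ω (adInv E g (c i)) (leftTriv g v) := by
  have key : ∀ i, ∃ c : E, ∀ g ∈ x.source, ∀ v : TangentSpace 𝓘(ℝ, E) g,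
      x.dcoord i g v = formCLM Ω (adInv E g c) (leftTriv g v) := by
    intro i
    let β : G → E →L[ℝ] ℝ := fun g ↦
      (mvfderiv 𝓘(ℝ, E) (x.coord i) g : E →L[ℝ] ℝ).comp (leftTrans g : E →L[ℝ] E)
    have hβ : ∀ g, ∀ v : TangentSpace 𝓘(ℝ, E) g, x.dcoord i g v = β g (leftTriv g v) := by
      intro g v
      exact congrArg (x.dcoord i g) (leftTrans_leftTriv g v).symm
    have hd : ∀ g ∈ x.source, HasLeftDerivAt β
        (-(formCLM Ω).comp ((bracketCLM E G).flip (sharpCLM Ω (β g)))) g := by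
      intro g hg
      refine HasLeftDerivAt.clm_of_apply fun η ↦ ?_
      -- Test on left-invariant fields, for which the covariant derivative is just the product ξ ·
      -- η: the result is dβ(ξ)(η) = β(ξ · η).
      obtain ⟨h1, h2⟩ := hx i g hg (fun _ ↦ mulInvariantVectorField (η : GroupLieAlgebra 𝓘(ℝ, E) G))
        (fun _ ↦ mdifferentiableAt_mulInvariantVectorField _)
      obtain ⟨f', hf'⟩ := exists_hasLeftDerivAt (f := fun h : G ↦ β h η) h1
      convert! hf' using 1
      ext ξ
      have h3 := h2 ((leftTrans g : E →L[ℝ] E) ξ)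
      have h4 := hf'.mvfderiv_apply ((leftTrans g : E →L[ℝ] E) ξ)
      rw [leftTriv_leftTrans'] at h4
      have h6 := leftTriv_connection_mulInvariantVectorField Ω (η : GroupLieAlgebra 𝓘(ℝ, E) G) g
        ((leftTrans g : E →L[ℝ] E) ξ)
      rw [leftTriv_leftTrans'] at h6
      have h7 : f' ξ = β g (productCLM Ω ξ η) := by
        refine h4.symm.trans (h3.trans ?_)
        rw [Fin.sum_univ_one]
        exact (hβ g _).trans (congrArg (β g) h6)
      rw [h7, ← formCLM_sharpCLM Ω (β g), formCLM_productCLM_right, formCLM_sharpCLM]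
      simp
    -- With β = Ω(b, ·) the equation for β becomes db = -[·, b].
    obtain ⟨c, hc⟩ := exists_eq_adInv x.open_source hc (b := fun g ↦ sharpCLM Ω (β g)) (by
      intro g hg
      refine ((sharpCLM Ω).hasFDerivAt.comp (unitPt E G) (hd g hg)).congr_fderiv ?_
      ext ξ
      simp [sharpCLM_formCLM])
    refine ⟨c, fun g hg v ↦ ?_⟩
    rw [hβ, ← hc g hg, formCLM_sharpCLM]
  choose c hc using key
  exact ⟨c, hc⟩

/-- Charts whose coordinate functions have differentials `i_{c⁻} Ω⁺` are affine. -/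
theorem Chart.isAffine_of_dcoord_eq {x : Chart E G n} {c : Fin n → E}
    (h : ∀ i, ∀ g ∈ x.source, ∀ v : TangentSpace 𝓘(ℝ, E) g,
      x.dcoord i g v = formCLM Ω (adInv E g (c i)) (leftTriv g v)) :
    x.IsAffine (connection Ω) := by
  intro i g hg Y hY
  obtain ⟨F', hF'⟩ := exists_hasLeftDerivAt (mdifferentiableAt_leftCoord (hY 0))
  have h1 : HasLeftDerivAt (fun h ↦ formCLM Ω (adInv E h (c i)) (leftCoord (Y 0) h)) _ g :=
    ((formCLM Ω).hasFDerivAt.comp (unitPt E G)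
    (hasLeftDerivAt_adInv_apply g (c i))).clm_apply hF'
  have h2 : (fun h ↦ x.dcoord i h (Y 0 h))
      =ᶠ[𝓝 g] fun h ↦ formCLM Ω (adInv E h (c i)) (leftCoord (Y 0) h) := by
    filter_upwards [x.open_source.mem_nhds hg] with h' hh'
    exact h i h' hh' _
  have h3 := h1.congr_of_eventuallyEq h2
  refine ⟨h3.mdifferentiableAt, fun v ↦ ?_⟩
  refine (h3.mvfderiv_apply v).trans ?_
  rw [Fin.sum_univ_one]
  refine Eq.trans ?_ (h i g hg (connection Ω (Y 0) g v)).symm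
  rw [leftTriv_connection Ω hF' v]
  -- With b = Ad g⁻¹ c_i, the derivative Ω(b, F' ξ) - Ω([ξ, b], F) equals Ω(b, F' ξ + ξ · F), and
  -- the second argument is the covariant derivative.
  have key : ∀ ξ : E, ((formCLM Ω (adInv E g (c i))).comp F'
      + (formCLM Ω ∘L (-(bracketCLM E G).flip (adInv E g (c i)))).flip (leftCoord (Y 0) g)) ξ
      = formCLM Ω (adInv E g (c i)) (F' ξ + productCLM Ω ξ (leftCoord (Y 0) g)) := by
    intro ξ
    rw [map_add, formCLM_productCLM_right]
    simp
  refine Eq.trans ?_ (key (leftTriv g v))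
  simp

/-- The coordinate function of a chart whose differentials are known. -/
theorem Chart.hasLeftDerivAt_coord {x : Chart E G n} {c : Fin n → E}
    (h : ∀ i, ∀ g ∈ x.source, ∀ v : TangentSpace 𝓘(ℝ, E) g,
      x.dcoord i g v = formCLM Ω (adInv E g (c i)) (leftTriv g v)) (i : Fin n) {g : G}
    (hg : g ∈ x.source) : HasLeftDerivAt (x.coord i) (formCLM Ω (adInv E g (c i))) g := by
  have h1 : MDifferentiableAt 𝓘(ℝ, E) 𝓘(ℝ, Fin n → ℝ) x g := x.mdifferentiableAt (by simp) hg
  have h2 : MDifferentiableAt 𝓘(ℝ, E) 𝓘(ℝ, ℝ) (x.coord i) g :=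
    (ContinuousLinearMap.proj (R := ℝ) (φ := fun _ : Fin n ↦ ℝ)
      i).differentiableAt.mdifferentiableAt.comp g h1
  obtain ⟨f', hf'⟩ := exists_hasLeftDerivAt h2
  convert! hf' using 1
  ext ξ
  have h4 := hf'.mvfderiv_apply ((leftTrans g : E →L[ℝ] E) ξ)
  have h5 := h i g hg ((leftTrans g : E →L[ℝ] E) ξ)
  rw [leftTriv_leftTrans'] at h4 h5
  exact h5.symm.trans h4

end AffineCharts

/-! ### Polynomial functions and right-invariant multivector fields -/

section PolynomialFunctions

variable {E : Type*} [NormedAddCommGroup E] [NormedSpace ℝ E]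
  {G : Type*} [TopologicalSpace G] [ChartedSpace E G] {n : ℕ} {x : Chart E G n}

theorem Chart.IsPolynomial.congr {f f' : G → ℝ} {d : ℕ} (h : x.IsPolynomial f d)
    (hf : ∀ g ∈ x.source, f' g = f g) : x.IsPolynomial f' d := by
  obtain ⟨p, hp, hpf⟩ := h
  exact ⟨p, hp, fun g hg ↦ (hf g hg).trans (hpf g hg)⟩

theorem Chart.IsPolynomial.mono {f : G → ℝ} {d d' : ℕ} (h : x.IsPolynomial f d) (hd : d ≤ d') :
    x.IsPolynomial f d' := by
  obtain ⟨p, hp, hpf⟩ := h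
  exact ⟨p, hp.trans hd, hpf⟩

theorem Chart.isPolynomial_of_source_eq_empty (hx : x.source = ∅) (f : G → ℝ) (d : ℕ) :
    x.IsPolynomial f d := ⟨0, by simp, by simp [hx]⟩

variable (x) in
theorem Chart.isPolynomial_const (a : ℝ) (d : ℕ) : x.IsPolynomial (fun _ ↦ a) d :=
  ⟨MvPolynomial.C a, by simp, by simp⟩

variable (x) in
theorem Chart.isPolynomial_coord (i : Fin n) : x.IsPolynomial (x.coord i) 1 :=
  ⟨MvPolynomial.X i, by simp, by simp [Chart.coord]⟩

theorem Chart.IsPolynomial.add {f f' : G → ℝ} {d : ℕ} (h : x.IsPolynomial f d)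
    (h' : x.IsPolynomial f' d) : x.IsPolynomial (fun g ↦ f g + f' g) d := by
  obtain ⟨p, hp, hpf⟩ := h
  obtain ⟨p', hp', hpf'⟩ := h'
  exact ⟨p + p', (MvPolynomial.totalDegree_add _ _).trans (max_le hp hp'),
    fun g hg ↦ by simp [hpf g hg, hpf' g hg]⟩

theorem Chart.IsPolynomial.mul {f f' : G → ℝ} {d d' : ℕ} (h : x.IsPolynomial f d)
    (h' : x.IsPolynomial f' d') : x.IsPolynomial (fun g ↦ f g * f' g) (d + d') := by
  obtain ⟨p, hp, hpf⟩ := h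
  obtain ⟨p', hp', hpf'⟩ := h'
  exact ⟨p * p', (MvPolynomial.totalDegree_mul _ _).trans (add_le_add hp hp'),
    fun g hg ↦ by simp [hpf g hg, hpf' g hg]⟩

theorem Chart.IsPolynomial.const_mul {f : G → ℝ} {d : ℕ} (h : x.IsPolynomial f d) (a : ℝ) :
    x.IsPolynomial (fun g ↦ a * f g) d := by
  simpa using (x.isPolynomial_const a 0).mul h

theorem Chart.IsPolynomial.sum {ι : Type*} {s : Finset ι} {f : ι → G → ℝ} {d : ℕ}
    (h : ∀ i ∈ s, x.IsPolynomial (f i) d) : x.IsPolynomial (fun g ↦ ∑ i ∈ s, f i g) d := by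
  classical
  induction s using Finset.induction_on with
  | empty => simpa using x.isPolynomial_const 0 d
  | insert a s ha ih =>
    simp only [Finset.sum_insert ha]
    exact (h a (Finset.mem_insert_self a s)).add
      (ih fun i hi ↦ h i (Finset.mem_insert_of_mem hi))

theorem Chart.IsPolynomial.prod {ι : Type*} {s : Finset ι} {f : ι → G → ℝ} {d : ι → ℕ}
    (h : ∀ i ∈ s, x.IsPolynomial (f i) (d i)) :
    x.IsPolynomial (fun g ↦ ∏ i ∈ s, f i g) (∑ i ∈ s, d i) := by
  classical
  induction s using Finset.induction_on with
  | empty => simpa using x.isPolynomial_const 1 0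
  | insert a s ha ih =>
    simp only [Finset.prod_insert ha, Finset.sum_insert ha]
    exact (h a (Finset.mem_insert_self a s)).mul
      (ih fun i hi ↦ h i (Finset.mem_insert_of_mem hi))

theorem Chart.isPolynomial_multilinear {V : Type*} [AddCommGroup V] [Module ℝ V] {k m : ℕ}
    (f : MultilinearMap ℝ (fun _ : Fin k ↦ V) ℝ) (w : Fin m → V) {q : Fin k → Fin m → G → ℝ}
    {d : ℕ} (hq : ∀ j l, x.IsPolynomial (q j l) d) :
    x.IsPolynomial (fun g ↦ f fun j ↦ ∑ l, q j l g • w l) (k * d) := by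
  simp only [MultilinearMap.map_sum, MultilinearMap.map_smul_univ, smul_eq_mul]
  refine Chart.IsPolynomial.sum fun r _ ↦ ?_
  have h1 := Chart.IsPolynomial.prod (s := Finset.univ) (x := x) (f := fun j ↦ q j (r j))
    (d := fun _ ↦ d) fun j _ ↦ hq j (r j)
  simpa using h1.mul (x.isPolynomial_const (f fun j ↦ w (r j)) 0)

/-- Each term of the Leibniz formula takes one factor from every row, so bounds attached to the rows
add up. -/
theorem Chart.isPolynomial_det {m : ℕ} {M : Matrix (Fin m) (Fin m) (G → ℝ)} {d : Fin m → ℕ}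
    (hM : ∀ i j, x.IsPolynomial (M i j) (d i)) :
    x.IsPolynomial (fun g ↦ (Matrix.of fun i j ↦ M i j g).det) (∑ i, d i) := by
  simp only [Matrix.det_apply', Matrix.of_apply]
  refine Chart.IsPolynomial.sum fun σ _ ↦ Chart.IsPolynomial.const_mul ?_ _
  have h := Chart.IsPolynomial.prod (s := Finset.univ) (x := x) (f := fun j ↦ M (σ j) j)
    (d := fun j ↦ d (σ j)) fun j _ ↦ hM (σ j) j
  rwa [Equiv.sum_comp σ d] at h

/-- The entries of the inverse of a matrix of functions which are polynomials of degree at most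
one, if its determinant is constant. -/
theorem Chart.isPolynomial_inv {m : ℕ} {M : Matrix (Fin m) (Fin m) (G → ℝ)}
    (hM : ∀ i j, x.IsPolynomial (M i j) 1) {D : ℝ}
    (hD : ∀ g ∈ x.source, (Matrix.of fun i j ↦ M i j g).det = D) (i j : Fin m) :
    x.IsPolynomial (fun g ↦ (Matrix.of fun i j ↦ M i j g)⁻¹ i j) (m - 1) := by
  have h1 : x.IsPolynomial (fun g ↦ (Matrix.of fun i j ↦ M i j g).adjugate i j) (m - 1) := by
    -- A cofactor is the determinant with row j replaced by a constant unit vector: that row has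
    -- degree 0, which saves one degree.
    let d : Fin m → ℕ := fun a ↦ if a = j then 0 else 1
    have hd : ∑ a, d a = m - 1 := by simp [d, Finset.sum_ite, ← ne_eq, Finset.filter_ne']
    have h := Chart.isPolynomial_det (x := x) (d := d)
      (M := Matrix.of fun a b ↦ if a = j then (fun _ ↦ if b = i then 1 else 0) else M a b) (by
        intro a b
        by_cases ha : a = j
        · simpa [d, ha] using x.isPolynomial_const (if b = i then 1 else 0) 0
        · simpa [d, ha] using hM a b)
    rw [hd] at h
    refine h.congr fun g _ ↦ ?_
    rw [Matrix.adjugate_apply]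
    congr 1
    ext a b
    by_cases ha : a = j
    · subst ha; simp [Pi.single_apply]
    · simp [ha]
  -- The inverse is the adjugate divided by D. For D = 0 the conventions on inverses make both sides
  -- zero.
  refine (h1.const_mul D⁻¹).congr fun g hg ↦ ?_
  simp [Matrix.inv_def, hD g hg]

end PolynomialFunctions

/-! ### Right translations of multivectors. -/

section RightTranslations

variable {E : Type*} [NormedAddCommGroup E] [NormedSpace ℝ E]
  {G : Type*} [TopologicalSpace G] [ChartedSpace E G] [Group G]

variable (E) in
/-- The differential at `1` of right translation by `g`, on the model space. -/
def rightTransOne (g : G) : E →L[ℝ] E := mfderiv 𝓘(ℝ, E) 𝓘(ℝ, E) (fun x : G ↦ x * g) 1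

theorem IsRightInvariantMultivector.apply_eq {k : ℕ}
    {P : (g : G) → (Module.Dual ℝ (TangentSpace 𝓘(ℝ, E) g)) [⋀^Fin k]→ₗ[ℝ] ℝ}
    (hP : IsRightInvariantMultivector P) (g : G) (θ : Fin k → Module.Dual ℝ E) :
    (P g : (Module.Dual ℝ E) [⋀^Fin k]→ₗ[ℝ] ℝ) θ
      = (P 1 : (Module.Dual ℝ E) [⋀^Fin k]→ₗ[ℝ] ℝ)
        fun j ↦ (θ j).comp (rightTransOne E g).toLinearMap := by
  have h : ∀ g', 1 * g = g' → (P g' : (Module.Dual ℝ E) [⋀^Fin k]→ₗ[ℝ] ℝ) θ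
      = (P 1 : (Module.Dual ℝ E) [⋀^Fin k]→ₗ[ℝ] ℝ)
        fun j ↦ (θ j).comp (rightTransOne E g).toLinearMap := by
    rintro _ rfl
    exact (congrArg (fun Q : (Module.Dual ℝ E) [⋀^Fin k]→ₗ[ℝ] ℝ ↦ Q θ) (hP g 1)).symm
  exact h g (one_mul g)

theorem leftTriv_rightTransOne [LieGroup 𝓘(ℝ, E) ∞ G] (g : G) (u : E) :
    (leftTriv g : E →L[ℝ] E) (rightTransOne E g u) = adInv E g u :=
  leftTriv_rightInvariantField (u : GroupLieAlgebra 𝓘(ℝ, E) G) g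

end RightTranslations

/-! ### Coefficients of multivectors in affine charts. -/

section AffineFrames

variable {E : Type*} [NormedAddCommGroup E] [NormedSpace ℝ E] [FiniteDimensional ℝ E]
  {G : Type*} [TopologicalSpace G] [ChartedSpace E G] [Group G] [LieGroup 𝓘(ℝ, E) ∞ G]
  (Ω : SymplecticCocycle (GroupLieAlgebra 𝓘(ℝ, E) G)) {n : ℕ}

/-- The differentials of the coordinate functions of `x` are the forms `i_{c⁻} Ω⁺`. -/
def Chart.HasFrame (x : Chart E G n) (c : Fin n → E) : Prop :=
  ∀ i, ∀ g ∈ x.source, ∀ v : TangentSpace 𝓘(ℝ, E) g,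
    x.dcoord i g v = formCLM Ω (adInv E g (c i)) (leftTriv g v)

variable {Ω} {x : Chart E G n}

/-- At a point of the domain the dx_i are dual to the coordinate vectors, and dx_i depends linearly
on c_i; a relation between the c_i would be one between the dx_i. An empty domain would not
constrain the c_i. -/
theorem Chart.IsAffine.exists_basis (hn : Module.finrank ℝ E = n)
    (hx : x.IsAffine (connection Ω)) (hc : IsPreconnected x.source) (hne : x.source.Nonempty) :
    ∃ c : Module.Basis (Fin n) ℝ E, x.HasFrame Ω c := by
  obtain ⟨c, h⟩ := hx.exists_dcoord_eq Ω hc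
  obtain ⟨g, hg⟩ := hne
  have hli : LinearIndependent ℝ c := by
    rw [Fintype.linearIndependent_iff]
    intro a ha j
    have h1 : ∑ i, a i * x.dcoord i g (x.coordVec j g) = 0 := by
      have h2 : ∀ i, a i * x.dcoord i g (x.coordVec j g)
          = formCLM Ω (adInv E g (a i • c i)) (leftTriv g (x.coordVec j g)) := fun i ↦ by
        rw [h i g hg, map_smul, map_smul]; rfl
      have h3 : ∀ ξ : E, ∑ i, formCLM Ω (adInv E g (a i • c i)) ξ = 0 := fun ξ ↦ by
        rw [← sum_apply, ← map_sum, ← map_sum, ha]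
        simp
      rw [Finset.sum_congr rfl fun i _ ↦ h2 i]
      exact h3 _
    simpa [x.dcoord_coordVec _ j hg] using h1
  refine ⟨Module.Basis.mk hli (hli.span_eq_top_of_card_eq_finrank' (by simp [hn])).ge, ?_⟩
  rw [Module.Basis.coe_mk]
  exact h

/-- The differential of the left side is i_{[u, v]⁻} Ω⁺. Expanding [u, v] in the basis c gives the
same combination of the dx_k, so the difference is constant on the connected domain. -/
theorem Chart.HasFrame.isPolynomial_form [ConnectedSpace G] {c : Module.Basis (Fin n) ℝ E}
    (h : x.HasFrame Ω c) (hc : IsPreconnected x.source) (u v : E) :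
    ∃ a : ℝ, ∀ g ∈ x.source, formCLM Ω (adInv E g u) (adInv E g v)
      = (∑ k, c.repr (bracketCLM E G u v) k * x.coord k g) + a := by
  let r := c.repr (bracketCLM E G u v)
  have h0 : ∀ g ∈ x.source, HasLeftDerivAt (fun g ↦ formCLM Ω (adInv E g u) (adInv E g v)
      - ∑ k, r k * x.coord k g) (0 : E →L[ℝ] ℝ) g := by
    intro g hg
    have h1 := HasFDerivAt.fun_sub (hasLeftDerivAt_formCLM_adInv Ω u v g)
      (HasFDerivAt.fun_sum (u := Finset.univ) fun k _ ↦
        HasFDerivAt.const_mul (Chart.hasLeftDerivAt_coord Ω h k hg) (r k))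
    refine HasFDerivAt.congr_fderiv h1 ?_
    have h2 : bracketCLM E G u v = ∑ k, r k • c k := (c.sum_repr _).symm
    rw [h2]
    simp only [map_sum, map_smul, sub_self]
  obtain hE | ⟨g₀, hg₀⟩ := x.source.eq_empty_or_nonempty
  · exact ⟨0, by simp [hE]⟩
  · refine ⟨formCLM Ω (adInv E g₀ u) (adInv E g₀ v) - ∑ k, r k * x.coord k g₀, fun g hg ↦ ?_⟩
    have := eq_of_hasLeftDerivAt_zero x.open_source hc h0 hg hg₀
    exact (sub_eq_iff_eq_add'.1 this)

theorem Chart.HasFrame.isPolynomial_one [ConnectedSpace G] {c : Module.Basis (Fin n) ℝ E}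
    (h : x.HasFrame Ω c) (hc : IsPreconnected x.source) (u v : E) :
    x.IsPolynomial (fun g ↦ formCLM Ω (adInv E g u) (adInv E g v)) 1 := by
  obtain ⟨a, ha⟩ := h.isPolynomial_form hc u v
  refine Chart.IsPolynomial.congr (Chart.IsPolynomial.add (Chart.IsPolynomial.sum fun k _ ↦
    (x.isPolynomial_coord k).const_mul _) (x.isPolynomial_const a 1)) ha

theorem poissonBivector_apply (g : G) (θ : Fin 2 → Module.Dual ℝ (TangentSpace 𝓘(ℝ, E) g))
    (b : Fin 2 → E) (h : ∀ j, ∀ v : TangentSpace 𝓘(ℝ, E) g,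
      θ j v = formCLM Ω (b j) (leftTriv g v)) :
    poissonBivector Ω g θ = formCLM Ω (b 0) (b 1) := by
  have h1 : ∀ j, Ω.sharp ((leftTrans g).toLinearMap.dualMap (θ j)) = b j := by
    intro j
    have h2 : (leftTrans g).toLinearMap.dualMap (θ j) = Ω.form.toDual Ω.nondegenerate (b j) := by
      refine LinearMap.ext fun ξ ↦ ?_
      refine (h j (leftTrans g ξ)).trans ?_
      rw [leftTriv_leftTrans]
      rfl
    rw [h2]
    exact (Ω.form.toDual Ω.nondegenerate).symm_apply_apply _
  have h3 : poissonBivector Ω g θ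
      = Ω.form (Ω.sharp ((leftTrans g).toLinearMap.dualMap (θ 0)))
        (Ω.sharp ((leftTrans g).toLinearMap.dualMap (θ 1))) := rfl
  rw [h3, h1, h1]
  rfl

theorem isPolynomialMultivector_poissonBivector [ConnectedSpace G] :
    IsPolynomialMultivector (connection Ω) (poissonBivector Ω) 1 := by
  intro x hx hc s
  obtain hE | hne := x.source.eq_empty_or_nonempty
  · exact Chart.isPolynomial_of_source_eq_empty hE _ _
  obtain ⟨c, h⟩ := hx.exists_basis rfl hc hne
  refine (h.isPolynomial_one hc (c (s 0)) (c (s 1))).congr fun g hg ↦ ?_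
  exact poissonBivector_apply g _ (fun j ↦ adInv E g (c (s j))) fun j v ↦ h (s j) g hg v

/-- Pull the covectors dx_i back to 1 by right translation. Their coordinates in the dual basis are
dx_i(c_l⁻) = Ω⁺(c_i⁻, c_l⁻), of degree at most one; evaluating a fixed k-vector multiplies k of
them. -/
theorem IsRightInvariantMultivector.isPolynomial [ConnectedSpace G] {k : ℕ}
    {P : (g : G) → (Module.Dual ℝ (TangentSpace 𝓘(ℝ, E) g)) [⋀^Fin k]→ₗ[ℝ] ℝ}
    (hP : IsRightInvariantMultivector P) : IsPolynomialMultivector (connection Ω) P k := by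
  intro x hx hc s
  obtain hE | hne := x.source.eq_empty_or_nonempty
  · exact Chart.isPolynomial_of_source_eq_empty hE _ _
  obtain ⟨c, h⟩ := hx.exists_basis rfl hc hne
  have h1 := Chart.isPolynomial_multilinear (x := x)
    (P 1 : (Module.Dual ℝ E) [⋀^Fin k]→ₗ[ℝ] ℝ).toMultilinearMap (fun l ↦ c.coord l)
    (q := fun j l g ↦ formCLM Ω (adInv E g (c (s j))) (adInv E g (c l)))
    fun j l ↦ h.isPolynomial_one hc _ _
  rw [mul_one] at h1
  refine h1.congr fun g hg ↦ ?_
  refine (hP.apply_eq g fun j ↦ x.dcoord (s j) g).trans ?_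
  have key : ∀ (a : Fin (Module.finrank ℝ E) → ℝ) (l : Fin (Module.finrank ℝ E)),
      (∑ l', a l' • c.coord l') (c l) = a l := fun a l ↦ by simp [Finsupp.single_apply]
  refine congrArg (P 1 : (Module.Dual ℝ E) [⋀^Fin k]→ₗ[ℝ] ℝ) (funext fun j ↦ ?_)
  refine c.ext fun l ↦ ?_
  refine (h (s j) g hg (rightTransOne E g (c l))).trans ?_
  refine (congrArg (formCLM Ω (adInv E g (c (s j)))) (leftTriv_rightTransOne g (c l))).trans ?_
  exact (key (fun l' ↦ formCLM Ω (adInv E g (c (s j))) (adInv E g (c l'))) l).symm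

end AffineFrames

/-! ### The unimodular case: polynomial forms -/

section CoordinateVectors

variable {E : Type*} [NormedAddCommGroup E] [NormedSpace ℝ E]
  {G : Type*} [TopologicalSpace G] [ChartedSpace E G] [Group G] [LieGroup 𝓘(ℝ, E) ∞ G] {n : ℕ}

/-- The element `u` of the Lie algebra such that the right-invariant field `u⁻` takes the value
`∂/∂x_j` at `g`. -/
def Chart.coordVecOne (x : Chart E G n) (j : Fin n) (g : G) : E :=
  adInv E g⁻¹ (leftTriv g (x.coordVec j g))

theorem Chart.adInv_coordVecOne (x : Chart E G n) (j : Fin n) (g : G) :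
    adInv E g (x.coordVecOne j g) = leftTriv g (x.coordVec j g) := by
  have := adInv_mul (E := E) g⁻¹ g
  rw [inv_mul_cancel, adInv_one] at this
  exact (congrArg (fun L : E →L[ℝ] E ↦ L (leftTriv g (x.coordVec j g))) this).symm

theorem Chart.rightTransOne_coordVecOne (x : Chart E G n) (j : Fin n) (g : G) :
    rightTransOne E g (x.coordVecOne j g) = x.coordVec j g := by
  have h := (leftTriv_rightTransOne g (x.coordVecOne j g)).trans (x.adInv_coordVecOne j g)
  have h1 := congrArg (leftTrans g : E →L[ℝ] E) h
  rw [leftTrans_leftTriv'] at h1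
  exact h1.trans (leftTrans_leftTriv g _)

end CoordinateVectors

section UnimodularForms

variable {E : Type*} [NormedAddCommGroup E] [NormedSpace ℝ E] [FiniteDimensional ℝ E]
  {G : Type*} [TopologicalSpace G] [ChartedSpace E G] [Group G] [LieGroup 𝓘(ℝ, E) ∞ G]
  {Ω : SymplecticCocycle (GroupLieAlgebra 𝓘(ℝ, E) G)} {n : ℕ} {x : Chart E G n}

theorem IsUnimodular.det_adInv_sq {E : Type*} [NormedAddCommGroup E] [NormedSpace ℝ E]
    {G : Type*} [TopologicalSpace G] [ChartedSpace E G] [Group G]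
    (hU : IsUnimodular E G) (g : G) :
    LinearMap.det (adInv E g).toLinearMap ^ 2 = 1 := by
  have h : |LinearMap.det (adInv E g).toLinearMap| = 1 := hU g⁻¹
  rw [← sq_abs, h, one_pow]

/-- The Gram matrix changes by the congruence NᵀMN, where N is the matrix of Ad g⁻¹. Only det(N)²
enters, so the sign left open by unimodularity is harmless. -/
theorem det_formCLM_adInv (hU : IsUnimodular E G) (c : Module.Basis (Fin n) ℝ E) (g : G) :
    (Matrix.of fun i j ↦ formCLM Ω (adInv E g (c i)) (adInv E g (c j))).det
      = (Matrix.of fun i j ↦ formCLM Ω (c i) (c j)).det := by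
  let N := LinearMap.toMatrix c c (adInv E g).toLinearMap
  have hN : ∀ i, adInv E g (c i) = ∑ k, N k i • c k := fun i ↦ by
    rw [← c.sum_repr (adInv E g (c i))]
    simp [N, LinearMap.toMatrix_apply]
  have h1 : (Matrix.of fun i j ↦ formCLM Ω (adInv E g (c i)) (adInv E g (c j)))
      = N.transpose * (Matrix.of fun i j ↦ formCLM Ω (c i) (c j)) * N := by
    ext i j
    rw [Matrix.of_apply, hN i, hN j]
    simp only [map_sum, map_smul, sum_apply, smul_apply, smul_eq_mul, Matrix.mul_apply,
      Matrix.transpose_apply, Matrix.of_apply, Finset.sum_mul, Finset.mul_sum]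
    refine Finset.sum_congr rfl fun k _ ↦ Finset.sum_congr rfl fun l _ ↦ ?_
    ring
  have h2 := hU.det_adInv_sq g
  rw [← LinearMap.det_toMatrix c] at h2
  rw [h1, Matrix.det_mul, Matrix.det_mul, Matrix.det_transpose, mul_right_comm, ← sq, h2, one_mul]

theorem Chart.HasFrame.formCLM_coordVec {c : Fin n → E} (h : x.HasFrame Ω c) (i j : Fin n)
    {g : G} (hg : g ∈ x.source) :
    formCLM Ω (adInv E g (c i)) (leftTriv g (x.coordVec j g)) = if i = j then 1 else 0 :=
  (h i g hg _).symm.trans (x.dcoord_coordVec i j hg)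

/-- Pair the expansion of ∂/∂x_j in the fields c_l⁻ with dx_i = i_{c_i⁻} Ω⁺ and use duality. -/
theorem Chart.HasFrame.repr_coordVecOne {c : Module.Basis (Fin n) ℝ E} (h : x.HasFrame Ω c)
    {g : G} (hg : g ∈ x.source) :
    (Matrix.of fun i j ↦ formCLM Ω (adInv E g (c i)) (adInv E g (c j)))⁻¹
      = Matrix.of fun l j ↦ c.repr (x.coordVecOne j g) l := by
  refine Matrix.inv_eq_right_inv ?_
  ext i j
  have h1 := h.formCLM_coordVec i j hg
  rw [← x.adInv_coordVecOne, ← c.sum_repr (x.coordVecOne j g)] at h1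
  simp only [map_sum, map_smul, smul_eq_mul] at h1
  rw [Matrix.mul_apply, Matrix.one_apply, ← h1]
  exact Finset.sum_congr rfl fun l _ ↦ mul_comm _ _

theorem Chart.HasFrame.isPolynomial_coordVecOne [ConnectedSpace G] (hU : IsUnimodular E G)
    {c : Module.Basis (Fin n) ℝ E} (h : x.HasFrame Ω c) (hc : IsPreconnected x.source)
    (j l : Fin n) : x.IsPolynomial (fun g ↦ c.repr (x.coordVecOne j g) l) (n - 1) := by
  have h1 := Chart.isPolynomial_inv (x := x)
    (M := Matrix.of fun i j g ↦ formCLM Ω (adInv E g (c i)) (adInv E g (c j)))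
    (fun i j ↦ h.isPolynomial_one hc _ _) (fun g _ ↦ det_formCLM_adInv hU c g) l j
  refine h1.congr fun g hg ↦ ?_
  exact (congrFun (congrFun (h.repr_coordVecOne hg) l) j).symm

theorem isPolynomialForm_symplecticForm [ConnectedSpace G] (hU : IsUnimodular E G) :
    IsPolynomialForm (connection Ω) (symplecticForm Ω) (Module.finrank ℝ E - 1) := by
  intro x hx hc s
  obtain hE | hne := x.source.eq_empty_or_nonempty
  · exact Chart.isPolynomial_of_source_eq_empty hE _ _
  obtain ⟨c, h⟩ := hx.exists_basis rfl hc hne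
  refine (h.isPolynomial_coordVecOne hU hc (s 0) (s 1)).congr fun g hg ↦ ?_
  have h1 : symplecticForm Ω g (fun j ↦ x.coordVec (s j) g)
      = formCLM Ω (leftTriv g (x.coordVec (s 0) g)) (leftTriv g (x.coordVec (s 1) g)) := rfl
  -- Only the first coordinate vector is expanded. The second is paired directly with the dx_l, so a
  -- single entry of the inverse matrix survives and the degree is not doubled.
  have h2 : ∀ w ξ : E, (∀ l, formCLM Ω (adInv E g (c l)) ξ = if l = s 1 then 1 else 0) →
      formCLM Ω (adInv E g w) ξ = c.repr w (s 1) := by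
    intro w ξ hξ
    conv_lhs => rw [← c.sum_repr w]
    simp only [map_sum, map_smul, sum_apply, smul_apply, hξ]
    simp
  rw [h1, ← x.adInv_coordVecOne (s 0)]
  exact h2 _ _ fun l ↦ h.formCLM_coordVec l (s 1) hg

theorem IsRightInvariantForm.apply_eq {E : Type*} [NormedAddCommGroup E] [NormedSpace ℝ E]
    {G : Type*} [TopologicalSpace G] [ChartedSpace E G] [Group G] {k : ℕ}
    {α : (g : G) → (TangentSpace 𝓘(ℝ, E) g) [⋀^Fin k]→ₗ[ℝ] ℝ}
    (hα : IsRightInvariantForm α) (g : G) (w : Fin k → E) :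
    (α g : E [⋀^Fin k]→ₗ[ℝ] ℝ) (fun j ↦ rightTransOne E g (w j))
      = (α 1 : E [⋀^Fin k]→ₗ[ℝ] ℝ) w := by
  have h : ∀ g', 1 * g = g' → (α g' : E [⋀^Fin k]→ₗ[ℝ] ℝ) (fun j ↦ rightTransOne E g (w j))
      = (α 1 : E [⋀^Fin k]→ₗ[ℝ] ℝ) w := by
    rintro _ rfl
    exact congrArg (fun β : E [⋀^Fin k]→ₗ[ℝ] ℝ ↦ β w) (hα g 1)
  exact h g (one_mul g)

/-- Right translation brings the coordinate vectors to 1, where each of the k arguments has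
coefficients of degree at most dim E - 1. -/
theorem IsRightInvariantForm.isPolynomial [ConnectedSpace G] (hU : IsUnimodular E G) {k : ℕ}
    {α : (g : G) → (TangentSpace 𝓘(ℝ, E) g) [⋀^Fin k]→ₗ[ℝ] ℝ}
    (hα : IsRightInvariantForm α) :
    IsPolynomialForm (connection Ω) α (k * (Module.finrank ℝ E - 1)) := by
  intro x hx hc s
  obtain hE | hne := x.source.eq_empty_or_nonempty
  · exact Chart.isPolynomial_of_source_eq_empty hE _ _
  obtain ⟨c, h⟩ := hx.exists_basis rfl hc hne
  have h1 := Chart.isPolynomial_multilinear (x := x)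
    (α 1 : E [⋀^Fin k]→ₗ[ℝ] ℝ).toMultilinearMap c
    (q := fun j l g ↦ c.repr (x.coordVecOne (s j) g) l)
    fun j l ↦ h.isPolynomial_coordVecOne hU hc _ _
  refine h1.congr fun g hg ↦ ?_
  have h2 := hα.apply_eq g fun j ↦ x.coordVecOne (s j) g
  simp only [Chart.rightTransOne_coordVecOne] at h2
  refine h2.trans ?_
  exact congrArg (α 1 : E [⋀^Fin k]→ₗ[ℝ] ℝ) (funext fun j ↦ (c.sum_repr _).symm)

end UnimodularForms

/-! ### The unimodular case: the parallel volume form -/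

section Wedge

variable {V W : Type*} [AddCommGroup V] [Module ℝ V] [AddCommGroup W] [Module ℝ W]

theorem wedge_compLinearMap {p q : ℕ} (α : V [⋀^Fin p]→ₗ[ℝ] ℝ) (β : V [⋀^Fin q]→ₗ[ℝ] ℝ)
    (f : W →ₗ[ℝ] V) :
    (wedge α β).compLinearMap f = wedge (α.compLinearMap f) (β.compLinearMap f) := by
  ext v
  simp only [wedge, AlternatingMap.compLinearMap_apply, AlternatingMap.domDomCongr_apply,
    LinearMap.compAlternatingMap_apply, AlternatingMap.domCoprod_apply, sum_apply,
    map_sum]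
  refine Finset.sum_congr rfl fun σ _ ↦ ?_
  induction σ using Quotient.inductionOn'
  rfl

theorem wedgePow_compLinearMap (α : V [⋀^Fin 2]→ₗ[ℝ] ℝ) (f : W →ₗ[ℝ] V) (m : ℕ) :
    (wedgePow α m).compLinearMap f = wedgePow (α.compLinearMap f) m := by
  induction m with
  | zero => rfl
  | succ m ih => exact (wedge_compLinearMap _ _ _).trans (by rw [ih]; rfl)

end Wedge

/-! ### Derivatives of alternating forms, and determinants. -/

section TopForms

variable {E : Type*} [NormedAddCommGroup E] [NormedSpace ℝ E] [FiniteDimensional ℝ E]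

/-- Alternating forms on a finite-dimensional space are continuous. -/
def formToContinuous {k : ℕ} (τ : E [⋀^Fin k]→ₗ[ℝ] ℝ) :
    ContinuousMultilinearMap ℝ (fun _ : Fin k ↦ E) ℝ where
  toMultilinearMap := τ.toMultilinearMap
  cont := by
    let e := Module.finBasis ℝ E
    have h : ∀ v : Fin k → E, τ v
        = ∑ r : Fin k → Fin (Module.finrank ℝ E), (∏ i, e.repr (v i) (r i)) * τ fun i ↦ e (r i) := by
      intro v
      have h1 : v = fun i ↦ ∑ l, e.repr (v i) l • e l := funext fun i ↦ (e.sum_repr _).symm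
      conv_lhs => rw [h1]
      have h2 := τ.toMultilinearMap.map_sum fun i l ↦ e.repr (v i) l • e l
      refine h2.trans (Finset.sum_congr rfl fun r _ ↦ ?_)
      exact τ.toMultilinearMap.map_smul_univ _ _
    have h3 : ∀ l, Continuous fun w : E ↦ e.repr w l := fun l ↦
      (LinearMap.toContinuousLinearMap (e.coord l)).continuous
    change Continuous fun v : Fin k → E ↦ τ v
    rw [funext h]
    fun_prop

@[simp] theorem formToContinuous_apply {k : ℕ} (τ : E [⋀^Fin k]→ₗ[ℝ] ℝ) (v : Fin k → E) :
    formToContinuous τ v = τ v := rfl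

theorem hasFDerivAt_form {k : ℕ} (τ : E [⋀^Fin k]→ₗ[ℝ] ℝ) {g : Fin k → E → E}
    {g' : Fin k → E →L[ℝ] E} {y : E} (hg : ∀ i, HasFDerivAt (g i) (g' i) y) :
    ∃ D : E →L[ℝ] ℝ, HasFDerivAt (fun z ↦ τ fun i ↦ g i z) D y ∧
      ∀ ξ, D ξ = ∑ i, τ (Function.update (fun j ↦ g j y) i (g' i ξ)) := by
  refine ⟨_, HasFDerivAt.multilinear_comp (formToContinuous τ) hg, fun ξ ↦ ?_⟩
  simp [ContinuousMultilinearMap.toContinuousLinearMap]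

theorem form_comp_eq_det_mul {k : ℕ} (hk : Module.finrank ℝ E = k) (τ : E [⋀^Fin k]→ₗ[ℝ] ℝ)
    (f : E →ₗ[ℝ] E) (v : Fin k → E) : τ (fun i ↦ f (v i)) = LinearMap.det f * τ v := by
  let e := Module.finBasisOfFinrankEq ℝ E hk
  rw [τ.eq_smul_basis_det e]
  have h := e.det_comp f v
  simp only [AlternatingMap.smul_apply, smul_eq_mul]
  rw [show (fun i ↦ f (v i)) = f ∘ v from rfl, h]
  ring

end TopForms

/-! ### Parallelism of left-invariant top forms. -/

section ParallelVolume

variable {E : Type*} [NormedAddCommGroup E] [NormedSpace ℝ E] [FiniteDimensional ℝ E]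
  {G : Type*} [TopologicalSpace G] [ChartedSpace E G] [Group G] [LieGroup 𝓘(ℝ, E) ∞ G]
  {Ω : SymplecticCocycle (GroupLieAlgebra 𝓘(ℝ, E) G)}

/-- Left-invariant forms whose value at the identity is annihilated by the product of the Lie
algebra are parallel. -/
theorem isParallelOn_leftInvariantForm {k : ℕ}
    (τ : (GroupLieAlgebra 𝓘(ℝ, E) G) [⋀^Fin k]→ₗ[ℝ] ℝ)
    (hτ : ∀ (ξ : E) (v : Fin k → E),
      ∑ i, (τ : E [⋀^Fin k]→ₗ[ℝ] ℝ) (Function.update v i (productCLM Ω ξ (v i))) = 0) :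
    IsParallelOn (connection Ω) (leftInvariantForm (G := G) τ) Set.univ := by
  intro g _ Y hY
  have hF : ∀ i, ∃ F' : E →L[ℝ] E, HasLeftDerivAt (leftCoord (Y i)) F' g := fun i ↦
    exists_hasLeftDerivAt (mdifferentiableAt_leftCoord (hY i))
  choose F' hF' using hF
  obtain ⟨D, hD, hDξ⟩ := hasFDerivAt_form (E := E) τ hF'
  have hD' : HasLeftDerivAt (fun h : G ↦ leftInvariantForm (G := G) τ h fun j ↦ Y j h) D g := hD
  refine ⟨hD'.mdifferentiableAt, fun v ↦ (hD'.mvfderiv_apply v).trans ?_⟩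
  have key : ∀ (ξ : E) (F : Fin k → E),
      ∑ i, (τ : E [⋀^Fin k]→ₗ[ℝ] ℝ) (Function.update F i (F' i ξ))
        = ∑ i, (τ : E [⋀^Fin k]→ₗ[ℝ] ℝ)
          (Function.update F i (F' i ξ + productCLM Ω ξ (F i))) := by
    intro ξ F
    -- The vanishing sum supplies the product terms which turn each ordinary derivative into a
    -- covariant one.
    rw [← add_zero (∑ i, _), ← hτ ξ F, ← Finset.sum_add_distrib]
    exact Finset.sum_congr rfl fun i _ ↦ (AlternatingMap.map_update_add _ _ _ _ _).symm
  refine (hDξ (leftTriv g v)).trans ?_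
  simp only [unitParam_unitPt, mul_one]
  refine (key (leftTriv g v) fun j ↦ leftCoord (Y j) g).trans ?_
  refine Finset.sum_congr rfl fun i _ ↦ ?_
  refine congrArg (τ : E [⋀^Fin k]→ₗ[ℝ] ℝ) (funext fun j ↦ ?_)
  by_cases hij : j = i
  · subst hij
    refine (Function.update_self (β := fun _ ↦ E) j _ _).trans
      ((leftTriv_connection Ω (hF' j) v).symm.trans (congrArg (leftTriv g) ?_))
    exact (Function.update_self (β := fun _ ↦ TangentSpace 𝓘(ℝ, E) g) j _ _).symm
  · refine (Function.update_of_ne (β := fun _ ↦ E) hij _ _).trans (congrArg (leftTriv g) ?_)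
    exact (Function.update_of_ne (β := fun _ ↦ TangentSpace 𝓘(ℝ, E) g) hij _
      (fun j ↦ Y j g)).symm

/-- The map S is the Ω-adjoint of A, that is Ω(S v, w) = Ω(v, A w); it is conjugate to the transpose
of A. -/
theorem det_formAdjoint (Ω : SymplecticCocycle (GroupLieAlgebra 𝓘(ℝ, E) G)) (A : E →L[ℝ] E) :
    ∃ S : E →ₗ[ℝ] E, LinearMap.det S = LinearMap.det A.toLinearMap ∧
      ∀ v, S v = sharpCLM Ω ((formCLM Ω v).comp A) := by
  let e : Module.Dual ℝ E ≃ₗ[ℝ] E := Ω.sharp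
  refine ⟨e.toLinearMap ∘ₗ A.toLinearMap.dualMap ∘ₗ e.symm.toLinearMap, ?_, fun v ↦ ?_⟩
  · rw [LinearMap.det_conj, LinearMap.det_dualMap]
  · rfl

/-- The sum is the trace of w ↦ ξ · w times τ(v). This map is the derivative at 1, in the direction
ξ, of the Ω-adjoints of Ad y⁻¹, which have determinant ±1 and so preserve τ(v)². -/
theorem sum_form_update_productCLM (hU : IsUnimodular E G) {k : ℕ}
    (hk : Module.finrank ℝ E = k) (τ : E [⋀^Fin k]→ₗ[ℝ] ℝ) (ξ : E) (v : Fin k → E) :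
    ∑ i, τ (Function.update v i (productCLM Ω ξ (v i))) = 0 := by
  have hS : ∀ w : E, HasFDerivAt (fun y : E ↦ sharpCLM Ω ((formCLM Ω w).comp
      (adInv E (unitParam G y)))) ((productCLM Ω).flip w) (unitPt E G) := by
    intro w
    have h := (sharpCLM Ω).hasFDerivAt.comp (unitPt E G)
      ((ContinuousLinearMap.compL ℝ E E ℝ (formCLM Ω w)).hasFDerivAt.comp (unitPt E G)
        (hasFDerivAt_adInv_unitParam E G))
    refine h.congr_fderiv ?_
    ext ξ
    refine formCLM_injective Ω ?_
    ext u
    simp [formCLM_sharpCLM, formCLM_productCLM]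
  obtain ⟨D, hD, hDξ⟩ := hasFDerivAt_form τ fun i ↦ hS (v i)
  have h1 : ∀ w : E, sharpCLM Ω ((formCLM Ω w).comp (adInv E (unitParam G (unitPt E G)))) = w := by
    intro w
    rw [unitParam_unitPt, adInv_one, ContinuousLinearMap.comp_id, sharpCLM_formCLM]
  simp only [h1] at hDξ
  have h2 : ∀ y : E, (τ fun i ↦ sharpCLM Ω ((formCLM Ω (v i)).comp (adInv E (unitParam G y)))) ^ 2
      = τ v ^ 2 := by
    intro y
    obtain ⟨S, hS1, hS2⟩ := det_formAdjoint Ω (adInv E (unitParam G y))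
    simp only [← hS2]
    rw [form_comp_eq_det_mul hk, mul_pow, hS1, hU.det_adInv_sq, one_mul]
  -- Constancy of the square gives 2 τ(v) D = 0. If τ(v) = 0, the function is itself identically
  -- zero.
  have h3 : D = 0 := by
    by_cases h0 : τ v = 0
    · have h4 : (fun y : E ↦ τ fun i ↦ sharpCLM Ω ((formCLM Ω (v i)).comp
          (adInv E (unitParam G y)))) = fun _ ↦ 0 := by
        funext y
        have := h2 y
        rw [h0] at this
        simpa using this
      rw [h4] at hD
      exact hD.unique (hasFDerivAt_const _ _)
    · have h4 := hD.pow 2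
      simp only [h2] at h4
      have h5 := h4.unique (hasFDerivAt_const _ _)
      simp only [h1] at h5
      simpa [h0] using h5
  exact (hDξ ξ).symm.trans (by rw [h3]; rfl)

/-- A skew-symmetric Gram matrix of odd size would have determinant zero, against nondegeneracy.
Evenness makes the exterior power of exponent `finrank / 2` a top form. -/
theorem SymplecticCocycle.even_finrank (Ω : SymplecticCocycle (GroupLieAlgebra 𝓘(ℝ, E) G)) :
    Even (Module.finrank ℝ E) := by
  let b := Module.finBasis ℝ E
  let M : Matrix (Fin (Module.finrank ℝ E)) (Fin (Module.finrank ℝ E)) ℝ :=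
    Matrix.of fun i j ↦ formCLM Ω (b i) (b j)
  have hdet : M.det ≠ 0 := by
    intro h0
    obtain ⟨v, hv, hMv⟩ := Matrix.exists_mulVec_eq_zero_iff.2 h0
    refine hv ?_
    have h1 : formCLM Ω (∑ j, v j • b j) = 0 := by
      refine ContinuousLinearMap.coe_injective (b.ext fun i ↦ ?_)
      have h2 := congrFun hMv i
      simp only [Matrix.mulVec, dotProduct, M, Matrix.of_apply, Pi.zero_apply] at h2
      change formCLM Ω (∑ j, v j • b j) (b i) = 0
      rw [formCLM_swap, map_sum]
      simp only [map_smul, smul_eq_mul]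
      rw [neg_eq_zero, ← h2]
      exact Finset.sum_congr rfl fun j _ ↦ mul_comm _ _
    have h2 : ∑ j, v j • b j = 0 := formCLM_injective Ω (h1.trans (map_zero _).symm)
    exact funext (Fintype.linearIndependent_iff.1 b.linearIndependent v h2)
  have hskew : M.transpose = -M := by
    ext i j
    simp [M, formCLM_swap Ω (b j) (b i)]
  have h1 := M.det_transpose
  rw [hskew, Matrix.det_neg, Fintype.card_fin] at h1
  by_contra hodd
  rw [(Nat.not_even_iff_odd.1 hodd).neg_one_pow] at h1
  exact hdet (by linarith)

theorem isParallelOn_wedgePow_symplecticForm (hU : IsUnimodular E G) :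
    IsParallelOn (connection Ω)
      (fun g ↦ wedgePow (symplecticForm Ω g) (Module.finrank ℝ E / 2)) Set.univ := by
  have h1 : (fun g ↦ wedgePow (symplecticForm Ω g) (Module.finrank ℝ E / 2))
      = leftInvariantForm (wedgePow Ω.toForm (Module.finrank ℝ E / 2)) :=
    funext fun g ↦ (wedgePow_compLinearMap _ _ _).symm
  rw [h1]
  refine isParallelOn_leftInvariantForm _ fun ξ v ↦ ?_
  exact sum_form_update_productCLM hU (Nat.two_mul_div_two_of_even Ω.even_finrank).symm _ ξ v

end ParallelVolume

/-! ### Existence of affine charts -/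

section ExistenceOfCharts

variable {E : Type*} [NormedAddCommGroup E] [NormedSpace ℝ E]
  {G : Type*} [TopologicalSpace G] [ChartedSpace E G] [Group G] [LieGroup 𝓘(ℝ, E) ∞ G]

/-- A chart of the group obtained by composing a translate of the chart at the identity with a
diffeomorphism between open subsets of vector spaces. -/
def translatedChart {n : ℕ} (g₀ : G) (Φ : OpenPartialHomeomorph E (Fin n → ℝ)) (s : Set E)
    (hs : IsOpen s) (hst : s ⊆ unitTarget E G) (hsΦ : s ⊆ Φ.source)
    (hΦ : ContDiffOn ℝ ∞ Φ s) (hΦ' : ContDiffOn ℝ ∞ Φ.symm (Φ '' s)) : Chart E G n where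
  toFun g := Φ (unitChart E G (g₀⁻¹ * g))
  invFun z := g₀ * unitParam G (Φ.symm z)
  source := {g | g₀⁻¹ * g ∈ unitSource E G ∧ unitChart E G (g₀⁻¹ * g) ∈ s}
  target := Φ '' s
  map_source' g hg := ⟨_, hg.2, rfl⟩
  map_target' := by
    rintro _ ⟨y, hy, rfl⟩
    simp only [Set.mem_ofPred_eq, inv_mul_cancel_left, Φ.left_inv (hsΦ hy)]
    rw [unitChart_unitParam (hst hy)]
    exact ⟨unitParam_mem (hst hy), hy⟩
  left_inv' g hg := by
    rw [Φ.left_inv (hsΦ hg.2), unitParam_unitChart hg.1, mul_inv_cancel_left]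
  right_inv' := by
    rintro _ ⟨y, hy, rfl⟩
    rw [Φ.left_inv (hsΦ hy), inv_mul_cancel_left, unitChart_unitParam (hst hy)]
  open_source := by
    have hc : Continuous fun g : G ↦ g₀⁻¹ * g :=
      (contMDiff_mul_left (I := 𝓘(ℝ, E)) (n := ∞) (a := g₀⁻¹)).continuous
    have h1 : IsOpen (unitSource E G ∩ unitChart E G ⁻¹' s) :=
      (continuousOn_extChartAt (I := 𝓘(ℝ, E)) (1 : G)).isOpen_inter_preimage
        (isOpen_unitSource E G) hs
    exact h1.preimage hc
  open_target := Φ.isOpen_image_of_subset_source hs hsΦ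
  contMDiffOn_toFun := by
    intro g hg
    have h1 : ContMDiffAt 𝓘(ℝ, E) 𝓘(ℝ, E) ∞ (fun g : G ↦ unitChart E G (g₀⁻¹ * g)) g :=
      (contMDiffAt_unitChart hg.1).comp g contMDiff_mul_left.contMDiffAt
    have h2 : ContMDiffAt 𝓘(ℝ, E) 𝓘(ℝ, Fin n → ℝ) ∞ Φ (unitChart E G (g₀⁻¹ * g)) :=
      (hΦ.contDiffAt (hs.mem_nhds hg.2)).contMDiffAt
    exact (h2.comp g h1).contMDiffWithinAt
  contMDiffOn_invFun := by
    rintro _ ⟨y, hy, rfl⟩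
    have h1 : ContMDiffAt 𝓘(ℝ, Fin n → ℝ) 𝓘(ℝ, E) ∞ (fun z ↦ unitParam G (Φ.symm z)) (Φ y) := by
      refine contMDiffAt_unitParam_comp (hΦ'.contDiffAt
        ((Φ.isOpen_image_of_subset_source hs hsΦ).mem_nhds ⟨y, hy, rfl⟩)) ?_
      rw [Φ.left_inv (hsΦ hy)]
      exact hst hy
    exact (contMDiffAt_const.mul h1).contMDiffWithinAt

variable [FiniteDimensional ℝ E] (Ω : SymplecticCocycle (GroupLieAlgebra 𝓘(ℝ, E) G))

/-- The one-form `i_{u⁻} Ω⁺` in the translate by `g₀` of the chart at the identity. -/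
def formChart (g₀ : G) (u : E) (y : E) : E →L[ℝ] ℝ :=
  (formCLM Ω (adInv E (g₀ * unitParam G y) u)).comp (maurerCartan G y)

theorem contDiffAt_formChart (g₀ : G) (u : E) {y : E} (hy : y ∈ unitTarget E G) :
    ContDiffAt ℝ ∞ (formChart Ω g₀ u) y := by
  have h1 : ContDiffAt ℝ ∞ (fun y : E ↦ adInv E (g₀ * unitParam G y) u) y := by
    simp only [adInv_mul]
    exact (contDiffAt_adInv_unitParam hy).clm_apply contDiffAt_const
  exact ((formCLM Ω).contDiff.contDiffAt.comp y h1).clm_comp (contDiffAt_maurerCartan hy)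

/-- The one-forms `i_{u⁻} Ω⁺` are closed. -/
theorem fderiv_formChart_symm (g₀ : G) (u : E) {y : E} (hy : y ∈ unitTarget E G) (b c : E) :
    fderiv ℝ (formChart Ω g₀ u) y b c = fderiv ℝ (formChart Ω g₀ u) y c b := by
  have h1 := (formCLM Ω).hasFDerivAt.comp y
    ((hasLeftDerivAt_adInv_apply (g₀ * unitParam G y) u).hasFDerivAt_unitParam hy)
  have h2 := ((contDiffAt_maurerCartan hy).differentiableAt (by simp)).hasFDerivAt
  have h3 : HasFDerivAt (formChart Ω g₀ u) _ y := h1.clm_comp h2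
  rw [h3.fderiv]
  -- With a = Ad g⁻¹ u at the point g, and B, C the Maurer–Cartan images of b, c, the
  -- antisymmetrized derivative is -Ω([B, a], C) + Ω([C, a], B) - Ω(a, [B, C]). It vanishes by the
  -- cocycle identity for (B, a, C).
  have h4 := fderiv_maurerCartan_sub hy b c
  have h5 := formCLM_cocycle Ω (maurerCartan G y b) (adInv E (g₀ * unitParam G y) u)
    (maurerCartan G y c)
  have h6 := congrArg (formCLM Ω (adInv E (g₀ * unitParam G y) u)) h4
  rw [formCLM_swap Ω (bracketCLM E G (maurerCartan G y c) (maurerCartan G y b)),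
    bracketCLM_swap (maurerCartan G y c) (maurerCartan G y b),
    bracketCLM_swap _ (maurerCartan G y c)] at h5
  simp at h5 h6 ⊢
  linarith

theorem injective_formCLM_adInv {n : ℕ} (u : Module.Basis (Fin n) ℝ E) (g : G) {v : E}
    (hv : ∀ i, formCLM Ω (adInv E g (u i)) v = 0) : v = 0 := by
  have h1 : ∀ w : E, formCLM Ω (adInv E g w) v = 0 := by
    intro w
    rw [← u.sum_repr w]
    simp only [map_sum, map_smul, sum_apply, smul_apply, hv]
    simp
  have h2 : ∀ w : E, formCLM Ω v w = 0 := by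
    intro w
    have := adInv_mul (E := E) g⁻¹ g
    rw [inv_mul_cancel, adInv_one] at this
    have h3 := congrArg (fun L : E →L[ℝ] E ↦ L w) this
    have h4 := h1 (adInv E g⁻¹ w)
    rw [formCLM_swap, show w = adInv E g (adInv E g⁻¹ w) from h3, h4, neg_zero]
  exact formCLM_injective Ω ((ContinuousLinearMap.ext h2).trans (map_zero _).symm)

/-- Integrate the closed one-forms i_{u_i⁻} Ω⁺ on a ball and use the primitives as coordinates; they
are independent because Ω is nondegenerate. -/
theorem exists_chart_hasFrame {n : ℕ} (u : Module.Basis (Fin n) ℝ E) (g₀ : G) :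
    ∃ x : Chart E G n, g₀ ∈ x.source ∧ IsPreconnected x.source ∧ x.HasFrame Ω u := by
  have hcomplete : CompleteSpace E := FiniteDimensional.complete ℝ E
  -- The Poincaré lemma is applied on a convex ball inside the chart.
  obtain ⟨r, hr, hball⟩ := Metric.mem_nhds_iff.1 (unitTarget_mem_nhds E G)
  have hprim : ∀ i, ∃ f : E → ℝ, ∀ y ∈ Metric.ball (unitPt E G) r,
      HasFDerivAt f (formChart Ω g₀ (u i) y) y := fun i ↦
    (convex_ball _ _).exists_forall_hasFDerivAt_of_fderiv_symmetric Metric.isOpen_ball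
      (fun y hy ↦ ((contDiffAt_formChart Ω g₀ (u i) (hball hy)).differentiableAt
        (by simp)).differentiableWithinAt)
      (fun y hy ↦ fderiv_formChart_symm Ω g₀ (u i) (hball hy))
  choose f hf using hprim
  let F : E → Fin n → ℝ := fun y i ↦ f i y
  let F' : E → E →L[ℝ] Fin n → ℝ := fun y ↦ ContinuousLinearMap.pi fun i ↦ formChart Ω g₀ (u i) y
  have hF : ∀ y ∈ Metric.ball (unitPt E G) r, HasFDerivAt F (F' y) y := fun y hy ↦
    hasFDerivAt_pi.2 fun i ↦ hf i y hy
  have hF's : ∀ y ∈ Metric.ball (unitPt E G) r, ContDiffAt ℝ ∞ F' y := by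
    intro y hy
    have h1 : ContDiffAt ℝ ∞ (fun y i ↦ formChart Ω g₀ (u i) y) y :=
      contDiffAt_pi.2 fun i ↦ contDiffAt_formChart Ω g₀ (u i) (hball hy)
    exact (ContinuousLinearMap.piEquivL ℝ E (fun _ : Fin n ↦ ℝ)).contDiff.contDiffAt.comp y h1
  have hFs : ContDiffOn ℝ ∞ F (Metric.ball (unitPt E G) r) := by
    rw [contDiffOn_infty_iff_fderiv_of_isOpen Metric.isOpen_ball]
    refine ⟨fun y hy ↦ (hF y hy).differentiableAt.differentiableWithinAt, fun y hy ↦ ?_⟩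
    refine ((hF's y hy).congr_of_eventuallyEq ?_).contDiffWithinAt
    filter_upwards [Metric.isOpen_ball.mem_nhds hy] with z hz
    exact (hF z hz).fderiv
  have he : unitPt E G ∈ Metric.ball (unitPt E G) r := Metric.mem_ball_self hr
  have hinj : Function.Injective (F' (unitPt E G)) := by
    rw [injective_iff_map_eq_zero]
    intro v hv
    refine injective_formCLM_adInv Ω u (g₀ * unitParam G (unitPt E G)) fun i ↦ ?_
    have := congrFun hv i
    simpa [F', formChart, maurerCartan_unitPt] using this
  have hdim : Module.finrank ℝ E = Module.finrank ℝ (Fin n → ℝ) := by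
    rw [Module.finrank_eq_card_basis u]; simp
  let L : E ≃L[ℝ] Fin n → ℝ :=
    (LinearEquiv.ofInjectiveOfFinrankEq (F' (unitPt E G)).toLinearMap hinj
      hdim).toContinuousLinearEquiv
  have hL : (L : E →L[ℝ] Fin n → ℝ) = F' (unitPt E G) := by ext; rfl
  have hFe : ContDiffAt ℝ ∞ F (unitPt E G) := hFs.contDiffAt (Metric.isOpen_ball.mem_nhds he)
  have hF'e : HasFDerivAt F (L : E →L[ℝ] Fin n → ℝ) (unitPt E G) := hL ▸ hF _ he
  let Φ := hFe.toOpenPartialHomeomorph F hF'e (by simp)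
  have hΦF : (Φ : E → Fin n → ℝ) = F := hFe.toOpenPartialHomeomorph_coe hF'e (by simp)
  have hΦe : unitPt E G ∈ Φ.source := hFe.mem_toOpenPartialHomeomorph_source hF'e (by simp)
  -- Shrink the ball so that the derivative stays invertible throughout: this makes the local
  -- inverse smooth at every point of the image.
  have hnhds : ∀ᶠ y in 𝓝 (unitPt E G), y ∈ Φ.source ∧ y ∈ Metric.ball (unitPt E G) r ∧
      F' y ∈ Set.range ((↑) : (E ≃L[ℝ] Fin n → ℝ) → E →L[ℝ] Fin n → ℝ) := by
    refine Filter.Eventually.and (Φ.open_source.mem_nhds hΦe)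
      (Filter.Eventually.and (Metric.isOpen_ball.mem_nhds he) ?_)
    exact (hF's _ he).continuousAt.preimage_mem_nhds (ContinuousLinearEquiv.isOpen.mem_nhds
      ⟨L, hL⟩)
  obtain ⟨r', hr', hball'⟩ := Metric.mem_nhds_iff.1 hnhds
  have hst : Metric.ball (unitPt E G) r' ⊆ unitTarget E G := fun y hy ↦ hball (hball' hy).2.1
  let x : Chart E G n := translatedChart g₀ Φ (Metric.ball (unitPt E G) r') Metric.isOpen_ball
    hst (fun y hy ↦ (hball' hy).1) (by
      rw [hΦF]; exact hFs.mono fun y hy ↦ (hball' hy).2.1) (by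
      rintro _ ⟨y, hy, rfl⟩
      obtain ⟨Ly, hLy⟩ := (hball' hy).2.2
      refine (Φ.contDiffAt_symm (f₀' := Ly) (Φ.map_source (hball' hy).1) ?_ ?_).contDiffWithinAt
      · rw [Φ.left_inv (hball' hy).1, hLy, hΦF]
        exact hF y (hball' hy).2.1
      · rw [Φ.left_inv (hball' hy).1, hΦF]
        exact hFs.contDiffAt (Metric.isOpen_ball.mem_nhds (hball' hy).2.1))
  have hsource : x.source = (fun y : E ↦ g₀ * unitParam G y) '' Metric.ball (unitPt E G) r' := by
    ext g
    constructor
    · intro hg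
      exact ⟨_, hg.2, by simp only [unitParam_unitChart hg.1, mul_inv_cancel_left]⟩
    · rintro ⟨y, hy, rfl⟩
      refine ⟨?_, ?_⟩
      · rw [inv_mul_cancel_left]; exact unitParam_mem (hst hy)
      · rw [inv_mul_cancel_left, unitChart_unitParam (hst hy)]; exact hy
  have hxF : ∀ y ∈ Metric.ball (unitPt E G) r', ∀ i, x.coord i (g₀ * unitParam G y) = f i y := by
    intro y hy i
    have h1 : x.coord i (g₀ * unitParam G y)
        = Φ (unitChart E G (g₀⁻¹ * (g₀ * unitParam G y))) i := rfl
    rw [h1, inv_mul_cancel_left, unitChart_unitParam (hst hy), hΦF]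
  refine ⟨x, ?_, ?_, ?_⟩
  · rw [hsource]
    exact ⟨_, Metric.mem_ball_self hr', by simp⟩
  · rw [hsource]
    have : IsTopologicalGroup G := topologicalGroup_of_lieGroup 𝓘(ℝ, E) ∞
    exact (convex_ball _ _).isPreconnected.image _ fun y hy ↦
      ((continuousAt_unitParam (hst hy)).const_mul g₀).continuousWithinAt
  · intro i g hg v
    have hg' := hg
    rw [hsource] at hg'
    obtain ⟨y, hy, rfl⟩ := hg'
    obtain ⟨f', hf'⟩ := exists_hasLeftDerivAt
      ((ContinuousLinearMap.proj (R := ℝ) (φ := fun _ : Fin n ↦ ℝ)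
        i).differentiableAt.mdifferentiableAt.comp (g₀ * unitParam G y)
          (x.mdifferentiableAt (by simp) hg) :
        MDifferentiableAt 𝓘(ℝ, E) 𝓘(ℝ, ℝ) (x.coord i) (g₀ * unitParam G y))
    have h1 := hf'.hasFDerivAt_unitParam (hst hy)
    have h2 : (fun z : E ↦ x.coord i (g₀ * unitParam G z)) =ᶠ[𝓝 y] f i := by
      filter_upwards [Metric.isOpen_ball.mem_nhds hy] with z hz
      exact hxF z hz i
    have h3 := h1.unique ((hf i y (hball' hy).2.1).congr_of_eventuallyEq h2)
    -- The invertible derivative `F' y` factors through `maurerCartan G y`, which is therefore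
    -- bijective and can be cancelled to read off the left derivative of the coordinate.
    have hMinj : Function.Injective (maurerCartan G y : E →L[ℝ] E) := by
      rw [injective_iff_map_eq_zero]
      intro w hw
      obtain ⟨Ly, hLy⟩ := (hball' hy).2.2
      refine Ly.injective ?_
      rw [map_zero]
      refine (congrArg (fun T : E →L[ℝ] Fin n → ℝ ↦ T w) hLy).trans ?_
      ext j
      simp [F', formChart, hw]
    have hMsurj : Function.Surjective (maurerCartan G y : E →L[ℝ] E) :=
      LinearMap.surjective_of_injective (f := (maurerCartan G y).toLinearMap) hMinj
    have h4 : f' = formCLM Ω (adInv E (g₀ * unitParam G y) (u i)) := by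
      ext w
      obtain ⟨w, rfl⟩ := hMsurj w
      exact congrArg (fun T : E →L[ℝ] ℝ ↦ T w) h3
    exact (hf'.mvfderiv_apply v).trans (by rw [h4])

theorem exists_affine_chart [ConnectedSpace G] {n : ℕ}
    (u : Module.Basis (Fin n) ℝ (GroupLieAlgebra 𝓘(ℝ, E) G)) (g₀ : G) :
    ∃ x : Chart E G n, g₀ ∈ x.source ∧ IsPreconnected x.source ∧
      x.IsAffine (connection Ω) ∧
      (∀ i, ∀ g ∈ x.source, ∀ v : TangentSpace 𝓘(ℝ, E) g,
        symplecticForm Ω g ![rightInvariantField (u i) g, v] = x.dcoord i g v) ∧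
      ∃ μ : Fin n → Fin n → ℝ, ∀ i j, ∀ g ∈ x.source,
        poissonBracket Ω (x.coord i) (x.coord j) g
          = (∑ k, u.repr ⁅u i, u j⁆ k * x.coord k g) + μ i j := by
  obtain ⟨x, hx, hxc, h⟩ := exists_chart_hasFrame Ω (u : Module.Basis (Fin n) ℝ E) g₀
  refine ⟨x, hx, hxc, Chart.isAffine_of_dcoord_eq Ω h, fun i g hg v ↦ ?_, ?_⟩
  · rw [h i g hg v]
    exact congrArg (fun a : E ↦ formCLM Ω a (leftTriv g v)) (leftTriv_rightInvariantField (u i) g)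
  · choose μ hμ using fun i j ↦ h.isPolynomial_form hxc (u i : E) (u j : E)
    refine ⟨μ, fun i j g hg ↦ ?_⟩
    have h1 : poissonBracket Ω (x.coord i) (x.coord j) g
        = formCLM Ω (adInv E g (u i)) (adInv E g (u j)) := by
      refine poissonBivector_apply g _ ![adInv E g (u i), adInv E g (u j)] fun l v ↦ ?_
      fin_cases l
      · exact h i g hg v
      · exact h j g hg v
    have : CompleteSpace E := FiniteDimensional.complete ℝ E
    have h2 := lie_eq_bracketCLM' (u i) (u j)
    rw [h1, h2]
    exact hμ i j g hg

end ExistenceOfCharts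

end SymplecticLieGroup
end

theorem theorem1p1 {E : Type*} [NormedAddCommGroup E] [NormedSpace ℝ E] [FiniteDimensional ℝ E]
    {G : Type*} [TopologicalSpace G] [ChartedSpace E G] [Group G] [LieGroup 𝓘(ℝ, E) ∞ G]
    [ConnectedSpace G] (n : ℕ) (hn : Module.finrank ℝ E = n)
    (Ω : SymplecticCocycle (GroupLieAlgebra 𝓘(ℝ, E) G)) :
    -- (1) affine coordinates in which the Poisson bracket is affine
    ((∀ (u : Module.Basis (Fin n) ℝ (GroupLieAlgebra 𝓘(ℝ, E) G)) (g₀ : G),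
        ∃ x : Chart E G n, g₀ ∈ x.source ∧ IsPreconnected x.source ∧
          x.IsAffine (connection Ω) ∧
          (∀ i, ∀ g ∈ x.source, ∀ v : TangentSpace 𝓘(ℝ, E) g,
            symplecticForm Ω g ![rightInvariantField (u i) g, v] = x.dcoord i g v) ∧
          ∃ μ : Fin n → Fin n → ℝ, ∀ i j, ∀ g ∈ x.source,
            poissonBracket Ω (x.coord i) (x.coord j) g
              = (∑ k, u.repr ⁅u i, u j⁆ k * x.coord k g) + μ i j) ∧
      IsPolynomialMultivector (connection Ω) (poissonBivector Ω) 1) ∧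
    -- (2) right-invariant multivector fields
    (∀ (k : ℕ)
        (P : (g : G) → (Module.Dual ℝ (TangentSpace 𝓘(ℝ, E) g)) [⋀^Fin k]→ₗ[ℝ] ℝ),
        IsRightInvariantMultivector P → IsPolynomialMultivector (connection Ω) P k) ∧
    -- (3) the unimodular case
    (IsUnimodular E G →
      IsPolynomialForm (connection Ω) (symplecticForm Ω) (n - 1) ∧
      IsParallelOn (connection Ω) (fun g ↦ wedgePow (symplecticForm Ω g) (n / 2)) Set.univ ∧
      ∀ (k : ℕ) (α : (g : G) → (TangentSpace 𝓘(ℝ, E) g) [⋀^Fin k]→ₗ[ℝ] ℝ),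
        IsRightInvariantForm α → ∃ d : ℕ, IsPolynomialForm (connection Ω) α d) := by
  subst hn
  refine ⟨⟨fun u g₀ ↦ exists_affine_chart Ω u g₀, isPolynomialMultivector_poissonBivector⟩,
    fun k P hP ↦ hP.isPolynomial, fun hU ↦ ⟨isPolynomialForm_symplecticForm hU,
      isParallelOn_wedgePow_symplecticForm hU, fun k α hα ↦ ⟨_, hα.isPolynomial hU⟩⟩⟩
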